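/- Let $N>2$, let $\Omega\subset\mathbb R^N$ be a bounded open set, let $\vec p=(p_1,\dots,p_N)$ with $p_i>1$ for all $i$, and define $\bar p$ by $\frac1{\bar p}=\frac1N\sum_{i=1}^N\frac1{p_i}$. Assume $\bar p<N$ and put $\bar p^*=\frac{N\bar p}{N-\bar p}$, $p_\infty=\max\{\bar p^*,\max_i p_i\}$, $p_i'=\frac{p_i}{p_i-1}$. Let $W^{1,\vec p}(\Omega)$ be the space of $u\in L^1(\Omega)$ with weak derivatives $\partial_{x_i}u\in L^{p_i}(\Omega)$, normed by $\|u\|_{L^1}+\sum_i\|\partial_{x_i}u\|_{L^{p_i}}$, and let $W_0^{1,\vec p}(\Omega)$ be the closure of $C_0^\infty(\Omega)$ in it. Assume, for all $i=1,\dots,N$: $(\mathcal H1)$ $\mathcal A_i:\Omega\times\mathbb R^N\to\mathbb R$ is a Carathéodory function and, for constants $0<\alpha\le\beta_i$, for a.e. $x\in\Omega$ and all $\xi,\eta\in\mathbb R^N$: $|\mathcal A_i(x,\xi)|\le\beta_i|\xi_i|^{p_i-1}$; $\ \alpha|\xi_i|^{p_i}\le\mathcal A_i(x,\xi)\,\xi_i$;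 and $\ 0<(\mathcal A_i(x,\xi)-\mathcal A_i(x,\eta))(\xi_i-\eta_i)$ whenever $\xi_i\ne\eta_i$. $(\mathcal H2)$ $\mathcal B_i:\Omega\times\mathbb R\to\mathbb R$ is a Carathéodory function with $|\mathcal B_i(x,s)|\le b_i(x)|s|^{\bar p/p_i'}$ for a.e. $x\in\Omega$ and all $s\in\mathbb R$, where $b_i:\Omega\to[0,\infty)$ is measurable and lies in the Marcinkiewicz space $L^{Np_i'/\bar p,\infty}(\Omega)$, i.e. $\sup_{t>0}t^{Np_i'/\bar p}\,|\{x\in\Omega: b_i(x)>t\}|<\infty$. $(\mathcal H3)$ Either $\mathcal G:\Omega\times\mathbb R\to\mathbb R$ is a Carathéodory function such that, for some constants $\tilde\mu\ge0$ and $1\le\gamma<p_\infty-1$, $|\mathcal G(x,s)|\le\tilde\mu|s|^\gamma$ and $\mathcal G(x,s)\,s\ge0$ for a.e. $x\in\Omega$ and all $s\in\mathbb R$; or $\mathcal G\equiv0$ (with no condition on $p_\infty$). $(\mathcal H4)$ $\mathcal F$ belongs to the dual space $(W_0^{1,\vec p}(\Omega))^*$. Let $u\in W_0^{1,\vec p}(\Omega)$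 be a weak solution of $$-\sum_{i=1}^N\partial_{x_i}\big[\mathcal A_i(x,\nabla u)+\mathcal B_i(x,u)\big]+\mathcal G(x,u)=\mathcal F\ \text{ in }\Omega,\qquad u=0\ \text{ on }\partial\Omega,$$ that is, $$\int_\Omega\Big[\sum_{i=1}^N\big(\mathcal A_i(x,\nabla u)+\mathcal B_i(x,u)\big)\,\partial_{x_i}\varphi+\mathcal G(x,u)\,\varphi\Big]dx=\langle\mathcal F,\varphi\rangle\qquad\forall\varphi\in C_0^\infty(\Omega).$$ If $\mathcal F\ge0$, i.e. $\langle\mathcal F,\varphi\rangle\ge0$ for every $\varphi\in W_0^{1,\vec p}(\Omega)$ with $\varphi\ge0$ a.e. in $\Omega$, then $u\ge0$ a.e. in $\Omega$. -/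

import Mathlib

open MeasureTheory Set TopologicalSpace Distributions
open scoped ENNReal

noncomputable section

namespace Aniso

/-! ### Exponents -/

/-- The harmonic mean `p̄` of `p₁, …, p_N`: `1 / p̄ = (1 / N) ∑ᵢ 1 / pᵢ`. -/
def harmonicMean {N : ℕ} (p : Fin N → ℝ) : ℝ := ((1 / (N : ℝ)) * ∑ i, 1 / p i)⁻¹

/-- The anisotropic Sobolev exponent `p̄* = N p̄ / (N - p̄)`, used when `p̄ < N`. -/
def sobolevExp {N : ℕ} (p : Fin N → ℝ) : ℝ :=
  (N : ℝ) * harmonicMean p / ((N : ℝ) - harmonicMean p)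

/-- `p_∞ = max {p̄*, maxᵢ pᵢ}`. -/
def pInfty {N : ℕ} (p : Fin N → ℝ) : ℝ := max (sobolevExp p) (⨆ i, p i)

/-- The conjugate exponent `q' = q / (q - 1)`, used when `q > 1`. -/
def conjExp (q : ℝ) : ℝ := q / (q - 1)

instance fact_one_le_ofReal (q : ℝ) [h : Fact (1 < q)] : Fact (1 ≤ ENNReal.ofReal q) :=
  ⟨ENNReal.one_le_ofReal.2 h.out.le⟩

/-! ### The anisotropic Sobolev spaces -/

section Sobolev

variable {N : ℕ}

/-- The classical partial derivative `∂ᵢ φ`. -/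
def partialDeriv (i : Fin N) (φ : EuclideanSpace ℝ (Fin N) → ℝ)
    (x : EuclideanSpace ℝ (Fin N)) : ℝ :=
  fderiv ℝ φ x (EuclideanSpace.single i 1)

/-- The Banach space `L¹(Ω) × ∏ᵢ L^{pᵢ}(Ω)`. Its norm is equivalent to
`‖u‖_{L¹} + ∑ᵢ ‖vᵢ‖_{L^{pᵢ}}`. -/
abbrev Ambient (Ω : Opens (EuclideanSpace ℝ (Fin N))) (p : Fin N → ℝ) : Type :=
  Lp ℝ 1 (volume.restrict (Ω : Set (EuclideanSpace ℝ (Fin N)))) ×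
    (∀ i, Lp ℝ (ENNReal.ofReal (p i)) (volume.restrict (Ω : Set (EuclideanSpace ℝ (Fin N)))))

variable (Ω : Opens (EuclideanSpace ℝ (Fin N)))

/-- `v` is the weak `i`-th partial derivative of `u` in `Ω`. -/
def IsWeakPartial (i : Fin N) (u v : EuclideanSpace ℝ (Fin N) → ℝ) : Prop :=
  ∀ φ : 𝓓(Ω, ℝ), ∫ x in (Ω : Set (EuclideanSpace ℝ (Fin N))), u x * partialDeriv i φ x =
    -∫ x in (Ω : Set (EuclideanSpace ℝ (Fin N))), v x * φ x

theorem continuous_partialDeriv (i : Fin N) (φ : 𝓓(Ω, ℝ)) : Continuous (partialDeriv i φ) :=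
  (φ.contDiff.continuous_fderiv (by simp)).clm_apply continuous_const

theorem hasCompactSupport_partialDeriv (i : Fin N) (φ : 𝓓(Ω, ℝ)) :
    HasCompactSupport (partialDeriv i φ) :=
  φ.hasCompactSupport.fderiv_apply ℝ _

theorem partialDeriv_add (i : Fin N) (φ ψ : 𝓓(Ω, ℝ)) (x : EuclideanSpace ℝ (Fin N)) :
    partialDeriv i (φ + ψ : 𝓓(Ω, ℝ)) x = partialDeriv i φ x + partialDeriv i ψ x := by
  have h : ((φ + ψ : 𝓓(Ω, ℝ)) : EuclideanSpace ℝ (Fin N) → ℝ) = fun y => φ y + ψ y := rfl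
  unfold partialDeriv
  rw [h, fderiv_fun_add ((φ.contDiff.differentiable (by simp)) x)
    ((ψ.contDiff.differentiable (by simp)) x)]
  rfl

theorem partialDeriv_smul (i : Fin N) (c : ℝ) (φ : 𝓓(Ω, ℝ)) (x : EuclideanSpace ℝ (Fin N)) :
    partialDeriv i (c • φ : 𝓓(Ω, ℝ)) x = c * partialDeriv i φ x := by
  have h : ((c • φ : 𝓓(Ω, ℝ)) : EuclideanSpace ℝ (Fin N) → ℝ) = fun y => c • φ y := rfl
  unfold partialDeriv
  rw [h, fderiv_fun_const_smul ((φ.contDiff.differentiable (by simp)) x)]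
  rfl

theorem integrable_mul {f g : EuclideanSpace ℝ (Fin N) → ℝ} {q : ℝ≥0∞} (hq : 1 ≤ q)
    (hf : MemLp f q (volume.restrict (Ω : Set (EuclideanSpace ℝ (Fin N)))))
    (hg : Continuous g) (hc : HasCompactSupport g) :
    IntegrableOn (fun x => f x * g x) (Ω : Set (EuclideanSpace ℝ (Fin N))) := by
  have : q.HolderConjugate (ENNReal.conjExponent q) := .conjExponent hq
  exact hf.integrable_mul (q := ENNReal.conjExponent q) (hg.memLp_of_hasCompactSupport hc)

/-- The anisotropic Sobolev space `W^{1,p⃗}(Ω)`: an element is an `L¹` function `u` together with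
its weak gradient `(∂₁u, …, ∂_N u)`, where `∂ᵢu ∈ L^{pᵢ}(Ω)`. -/
def W1 (p : Fin N → ℝ) [∀ i, Fact (1 < p i)] : Submodule ℝ (Ambient Ω p) where
  carrier := {w | ∀ i, IsWeakPartial Ω i w.1 (w.2 i)}
  zero_mem' := by
    intro i φ
    have h1 : ((0 : Ambient Ω p).1 : EuclideanSpace ℝ (Fin N) → ℝ)
        =ᵐ[volume.restrict (Ω : Set (EuclideanSpace ℝ (Fin N)))] 0 := Lp.coeFn_zero ..
    have h2 : ((0 : Ambient Ω p).2 i : EuclideanSpace ℝ (Fin N) → ℝ)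
        =ᵐ[volume.restrict (Ω : Set (EuclideanSpace ℝ (Fin N)))] 0 := Lp.coeFn_zero ..
    rw [integral_eq_zero_of_ae, integral_eq_zero_of_ae, neg_zero]
    · filter_upwards [h2] with x hx
      exact (congrArg (· * φ x) hx).trans (zero_mul _)
    · filter_upwards [h1] with x hx
      exact (congrArg (· * partialDeriv i φ x) hx).trans (zero_mul _)
  add_mem' := by
    intro a b ha hb i φ
    have h1 := Lp.coeFn_add a.1 b.1
    have h2 := Lp.coeFn_add (a.2 i) (b.2 i)
    have hp : 1 ≤ ENNReal.ofReal (p i) := Fact.out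
    have e1 : ∫ x in (Ω : Set (EuclideanSpace ℝ (Fin N))), (a + b).1 x * partialDeriv i φ x =
        ∫ x in (Ω : Set (EuclideanSpace ℝ (Fin N))),
          (a.1 x * partialDeriv i φ x + b.1 x * partialDeriv i φ x) := by
      apply integral_congr_ae
      filter_upwards [h1] with x hx
      rw [Prod.fst_add, hx, Pi.add_apply, add_mul]
    have e2 : ∫ x in (Ω : Set (EuclideanSpace ℝ (Fin N))), (a + b).2 i x * φ x =
        ∫ x in (Ω : Set (EuclideanSpace ℝ (Fin N))), (a.2 i x * φ x + b.2 i x * φ x) := by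
      apply integral_congr_ae
      filter_upwards [h2] with x hx
      rw [Prod.snd_add, Pi.add_apply, hx, Pi.add_apply, add_mul]
    rw [e1, e2, integral_add, integral_add, ha i φ, hb i φ, neg_add]
    · exact integrable_mul Ω hp (Lp.memLp _) φ.continuous φ.hasCompactSupport
    · exact integrable_mul Ω hp (Lp.memLp _) φ.continuous φ.hasCompactSupport
    · exact integrable_mul Ω le_rfl (Lp.memLp _) (continuous_partialDeriv Ω i φ)
        (hasCompactSupport_partialDeriv Ω i φ)
    · exact integrable_mul Ω le_rfl (Lp.memLp _) (continuous_partialDeriv Ω i φ)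
        (hasCompactSupport_partialDeriv Ω i φ)
  smul_mem' := by
    intro c a ha i φ
    have h1 := Lp.coeFn_smul c a.1
    have h2 := Lp.coeFn_smul c (a.2 i)
    have e1 : ∫ x in (Ω : Set (EuclideanSpace ℝ (Fin N))), (c • a).1 x * partialDeriv i φ x =
        ∫ x in (Ω : Set (EuclideanSpace ℝ (Fin N))), c * (a.1 x * partialDeriv i φ x) := by
      apply integral_congr_ae
      filter_upwards [h1] with x hx
      rw [Prod.smul_fst, hx, Pi.smul_apply, smul_eq_mul, mul_assoc]
    have e2 : ∫ x in (Ω : Set (EuclideanSpace ℝ (Fin N))), (c • a).2 i x * φ x =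
        ∫ x in (Ω : Set (EuclideanSpace ℝ (Fin N))), c * (a.2 i x * φ x) := by
      apply integral_congr_ae
      filter_upwards [h2] with x hx
      rw [Prod.smul_snd, Pi.smul_apply, hx, Pi.smul_apply, smul_eq_mul, mul_assoc]
    rw [e1, e2, integral_const_mul, integral_const_mul, ha i φ, mul_neg]

theorem memLp_test (φ : 𝓓(Ω, ℝ)) (q : ℝ≥0∞) :
    MemLp φ q (volume.restrict (Ω : Set (EuclideanSpace ℝ (Fin N)))) :=
  φ.continuous.memLp_of_hasCompactSupport φ.hasCompactSupport

theorem memLp_partialDeriv (i : Fin N) (φ : 𝓓(Ω, ℝ)) (q : ℝ≥0∞) :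
    MemLp (partialDeriv i φ) q (volume.restrict (Ω : Set (EuclideanSpace ℝ (Fin N)))) :=
  (continuous_partialDeriv Ω i φ).memLp_of_hasCompactSupport (hasCompactSupport_partialDeriv Ω i φ)

/-- The classical partial derivatives of a test function are its weak ones. -/
theorem isWeakPartial_test (i : Fin N) (ψ : 𝓓(Ω, ℝ)) :
    IsWeakPartial Ω i ψ (partialDeriv i ψ) := by
  intro φ
  have hφ : ∀ x, x ∉ (Ω : Set (EuclideanSpace ℝ (Fin N))) → φ x = 0 := fun x hx =>
    image_eq_zero_of_notMem_tsupport fun h => hx (φ.tsupport_subset h)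
  have hψ : ∀ x, x ∉ (Ω : Set (EuclideanSpace ℝ (Fin N))) → ψ x = 0 := fun x hx =>
    image_eq_zero_of_notMem_tsupport fun h => hx (ψ.tsupport_subset h)
  rw [setIntegral_eq_integral_of_forall_compl_eq_zero (fun x hx => by simp [hψ x hx]),
    setIntegral_eq_integral_of_forall_compl_eq_zero (fun x hx => by simp [hφ x hx])]
  refine integral_mul_fderiv_eq_neg_fderiv_mul_of_integrable ?_ ?_ ?_
    (fun x _ => (ψ.contDiff.differentiable (by simp)) x)
    (fun x _ => (φ.contDiff.differentiable (by simp)) x)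
  · exact ((continuous_partialDeriv Ω i ψ).mul φ.continuous).integrable_of_hasCompactSupport
      (hasCompactSupport_partialDeriv Ω i ψ).mul_right
  · exact (ψ.continuous.mul (continuous_partialDeriv Ω i φ)).integrable_of_hasCompactSupport
      ψ.hasCompactSupport.mul_right
  · exact (ψ.continuous.mul φ.continuous).integrable_of_hasCompactSupport
      ψ.hasCompactSupport.mul_right

/-- The embedding `φ ↦ (φ, ∇φ)` of `C₀^∞(Ω)` into `W^{1,p⃗}(Ω)`. -/
def ofTest (p : Fin N → ℝ) [∀ i, Fact (1 < p i)] : 𝓓(Ω, ℝ) →ₗ[ℝ] W1 Ω p where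
  toFun φ := ⟨((memLp_test Ω φ 1).toLp φ,
      fun i => (memLp_partialDeriv Ω i φ (ENNReal.ofReal (p i))).toLp (partialDeriv i φ)), by
    intro i ψ
    have h1 := (memLp_test Ω φ 1).coeFn_toLp
    have h2 := (memLp_partialDeriv Ω i φ (ENNReal.ofReal (p i))).coeFn_toLp
    refine Eq.trans (integral_congr_ae ?_)
      ((isWeakPartial_test Ω i φ ψ).trans (congrArg Neg.neg (integral_congr_ae ?_)))
    · filter_upwards [h1] with x hx
      rw [hx]
    · filter_upwards [h2] with x hx
      rw [hx]⟩
  map_add' φ ψ := by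
    refine Subtype.ext (Prod.ext ?_ (funext fun i => ?_))
    · rfl
    · refine Eq.trans ?_ (MemLp.toLp_add (memLp_partialDeriv Ω i φ _)
        (memLp_partialDeriv Ω i ψ _))
      exact MemLp.toLp_congr (memLp_partialDeriv Ω i (φ + ψ) _) _
        (.of_forall fun x => partialDeriv_add Ω i φ ψ x)
  map_smul' c φ := by
    refine Subtype.ext (Prod.ext ?_ (funext fun i => ?_))
    · rfl
    · refine Eq.trans ?_ (MemLp.toLp_const_smul c (memLp_partialDeriv Ω i φ _))
      exact MemLp.toLp_congr (memLp_partialDeriv Ω i (c • φ) _) _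
        (.of_forall fun x => partialDeriv_smul Ω i c φ x)

/-- The space `W₀^{1,p⃗}(Ω)`: the closure of `C₀^∞(Ω)` in `W^{1,p⃗}(Ω)`. For bounded `Ω` the norm
is, by the Poincaré inequality, equivalent on it to `∑ᵢ ‖∂ᵢu‖_{L^{pᵢ}}`. -/
def W10 (p : Fin N → ℝ) [∀ i, Fact (1 < p i)] : Submodule ℝ (W1 Ω p) :=
  (LinearMap.range (ofTest Ω p)).topologicalClosure

/-- A test function as an element of `W₀^{1,p⃗}(Ω)`. -/
def testW10 (p : Fin N → ℝ) [∀ i, Fact (1 < p i)] (φ : 𝓓(Ω, ℝ)) : W10 Ω p :=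
  ⟨ofTest Ω p φ, Submodule.le_topologicalClosure _ ⟨φ, rfl⟩⟩

variable {Ω}

/-- The function underlying an element of `W₀^{1,p⃗}(Ω)` (defined a.e. in `Ω`). -/
def W10.val {p : Fin N → ℝ} [∀ i, Fact (1 < p i)] (u : W10 Ω p) :
    EuclideanSpace ℝ (Fin N) → ℝ := u.1.1.1

/-- The weak gradient of an element of `W₀^{1,p⃗}(Ω)` (defined a.e. in `Ω`). -/
def W10.grad {p : Fin N → ℝ} [∀ i, Fact (1 < p i)] (u : W10 Ω p)
    (x : EuclideanSpace ℝ (Fin N)) : Fin N → ℝ := fun i => u.1.1.2 i x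

end Sobolev

/-! ### Structural assumptions -/

/-- Carathéodory functions `f : Ω × S → ℝ`: (Lebesgue) measurable in `x ∈ Ω` for every `s`, and
continuous in `s` for a.e. `x ∈ Ω`. -/
def IsCaratheodory {N : ℕ} (Ω : Opens (EuclideanSpace ℝ (Fin N))) {S : Type*} [TopologicalSpace S]
    (f : EuclideanSpace ℝ (Fin N) → S → ℝ) : Prop :=
  (∀ s, AEMeasurable (fun x => f x s)
    (volume.restrict (Ω : Set (EuclideanSpace ℝ (Fin N))))) ∧
  ∀ᵐ x ∂(volume.restrict (Ω : Set (EuclideanSpace ℝ (Fin N)))), Continuous (f x)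

/-- The Marcinkiewicz (weak Lebesgue) space `L^{q,∞}(Ω)`: measurable `f` with
`sup_{t > 0} t^q |{x ∈ Ω : |f x| > t}| < ∞`. -/
def MemWeakLp {N : ℕ} (Ω : Opens (EuclideanSpace ℝ (Fin N)))
    (f : EuclideanSpace ℝ (Fin N) → ℝ) (q : ℝ) : Prop :=
  AEMeasurable f (volume.restrict (Ω : Set (EuclideanSpace ℝ (Fin N)))) ∧
  (⨆ t ∈ Ioi (0 : ℝ), ENNReal.ofReal (t ^ q) * volume {x | x ∈ Ω ∧ t < |f x|}) < ∞

/-- Assumption on the principal part `𝒜 = (𝒜₁, …, 𝒜_N)`: growth, coercivity and strict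
monotonicity of each component. -/
structure HypA {N : ℕ} (Ω : Opens (EuclideanSpace ℝ (Fin N))) (p : Fin N → ℝ)
    (A : Fin N → EuclideanSpace ℝ (Fin N) → (Fin N → ℝ) → ℝ) (α : ℝ) (β : Fin N → ℝ) : Prop where
  alpha_pos : 0 < α
  alpha_le : ∀ i, α ≤ β i
  caratheodory : ∀ i, IsCaratheodory Ω (A i)
  growth : ∀ i, ∀ᵐ x ∂(volume.restrict (Ω : Set (EuclideanSpace ℝ (Fin N)))),
    ∀ ξ : Fin N → ℝ, |A i x ξ| ≤ β i * |ξ i| ^ (p i - 1)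
  coercive : ∀ i, ∀ᵐ x ∂(volume.restrict (Ω : Set (EuclideanSpace ℝ (Fin N)))),
    ∀ ξ : Fin N → ℝ, α * |ξ i| ^ p i ≤ A i x ξ * ξ i
  monotone : ∀ i, ∀ᵐ x ∂(volume.restrict (Ω : Set (EuclideanSpace ℝ (Fin N)))),
    ∀ ξ η : Fin N → ℝ, ξ i ≠ η i → 0 < (A i x ξ - A i x η) * (ξ i - η i)

/-- Assumption on the convection term `ℬ = (ℬ₁, …, ℬ_N)`, with coefficients `bᵢ`. -/
structure HypB {N : ℕ} (Ω : Opens (EuclideanSpace ℝ (Fin N))) (p : Fin N → ℝ)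
    (B : Fin N → EuclideanSpace ℝ (Fin N) → ℝ → ℝ) (b : Fin N → EuclideanSpace ℝ (Fin N) → ℝ) :
    Prop where
  caratheodory : ∀ i, IsCaratheodory Ω (B i)
  nonneg : ∀ i, ∀ x ∈ Ω, 0 ≤ b i x
  memWeakLp : ∀ i, MemWeakLp Ω (b i) ((N : ℝ) * conjExp (p i) / harmonicMean p)
  growth : ∀ i, ∀ᵐ x ∂(volume.restrict (Ω : Set (EuclideanSpace ℝ (Fin N)))),
    ∀ s : ℝ, |B i x s| ≤ b i x * |s| ^ (harmonicMean p / conjExp (p i))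

/-- Assumption on the zero order term `𝒢`: growth with exponent `γ` and the sign condition. -/
structure HypG {N : ℕ} (Ω : Opens (EuclideanSpace ℝ (Fin N))) (p : Fin N → ℝ)
    (G : EuclideanSpace ℝ (Fin N) → ℝ → ℝ) (μ γ : ℝ) : Prop where
  mu_nonneg : 0 ≤ μ
  one_le_gamma : 1 ≤ γ
  gamma_lt : γ < pInfty p - 1
  caratheodory : IsCaratheodory Ω G
  growth : ∀ᵐ x ∂(volume.restrict (Ω : Set (EuclideanSpace ℝ (Fin N)))),
    ∀ s : ℝ, |G x s| ≤ μ * |s| ^ γ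
  sign : ∀ᵐ x ∂(volume.restrict (Ω : Set (EuclideanSpace ℝ (Fin N)))),
    ∀ s : ℝ, 0 ≤ G x s * s

/-! ### Weak solutions -/

/-- `u ∈ W₀^{1,p⃗}(Ω)` is a weak solution of
`-∑ᵢ ∂ᵢ [𝒜ᵢ(x, ∇u) + ℬᵢ(x, u)] + 𝒢(x, u) = ℱ` in `Ω`, `u = 0` on `∂Ω`, where `ℱ` is in the dual
space of `W₀^{1,p⃗}(Ω)`. -/
def IsWeakSolution {N : ℕ} {Ω : Opens (EuclideanSpace ℝ (Fin N))} {p : Fin N → ℝ}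
    [∀ i, Fact (1 < p i)]
    (A : Fin N → EuclideanSpace ℝ (Fin N) → (Fin N → ℝ) → ℝ)
    (B : Fin N → EuclideanSpace ℝ (Fin N) → ℝ → ℝ)
    (G : EuclideanSpace ℝ (Fin N) → ℝ → ℝ) (F : StrongDual ℝ (W10 Ω p)) (u : W10 Ω p) : Prop :=
  ∀ φ : 𝓓(Ω, ℝ),
    ∫ x in (Ω : Set (EuclideanSpace ℝ (Fin N))),
      ((∑ i, (A i x (W10.grad u x) + B i x (W10.val u x)) * partialDeriv i φ x)
        + G x (W10.val u x) * φ x)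
    = F (testW10 Ω p φ)

/-- `ℱ ≥ 0`: `⟨ℱ, φ⟩ ≥ 0` for every `φ ∈ W₀^{1,p⃗}(Ω)` with `φ ≥ 0` a.e. in `Ω`. -/
def DualNonneg {N : ℕ} {Ω : Opens (EuclideanSpace ℝ (Fin N))} {p : Fin N → ℝ}
    [∀ i, Fact (1 < p i)] (F : StrongDual ℝ (W10 Ω p)) : Prop :=
  ∀ φ : W10 Ω p, (∀ᵐ x ∂(volume.restrict (Ω : Set (EuclideanSpace ℝ (Fin N)))),
    0 ≤ W10.val φ x) → 0 ≤ F φ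

end Aniso

end

/-! Test the equation with `negTrunc ε u`, a smooth nonnegative version of `min (u⁻) ε`. The datum
makes the tested integral nonnegative, while the zero order term contributes something nonpositive
by its sign condition. Coercivity and Young's inequality then bound `∫ |H'(u)| |∂ⱼu|^{pⱼ}`, with `H
= negTrunc ε`, by the convection term. Since `H'` lives on `{-ε < u < 0}`, where `|u|^{p̄} ≤
ε^{p̄}`, that bound is `ε^{p̄} J(ε)` up to a constant, `J(ε)` being a weighted sum of the integrals
of `bᵢ^{pᵢ'}` over the band `{-ε < u < 0}` (`IsWeakSolution.energy_le`). The bands shrink to the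
empty set, so `J(ε) → 0` by dominated convergence.

On the other side, integrating by parts against the bounded coordinate `xⱼ` controls `∫ H(u)`, hence
`ε |{u ≤ -ε}|`, by `∫ |H'(u)| |∂ⱼu|`. Young's inequality at scale `κε` gives `|{u ≤ -ε}| ≤ c κ +
c(κ) ε^{-pⱼ} ∫ |H'(u)| |∂ⱼu|^{pⱼ}` (`W10.measure_sublevel_le`). A direction with `pⱼ ≤ p̄` always
exists, because `p̄` is a harmonic mean; for it the powers of `ε` cancel when `ε ≤ 1`, and `|{u ≤
-ε}| ≤ c κ + c(κ) J(ε)`. Letting `ε → 0` and then `κ → 0` yields `|{u < 0}| = 0`.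

The rest of the work makes this test function legitimate, that is, puts `ℬᵢ(x, u)` in `L^{pᵢ'}` and
`𝒢(x, u)` in `L¹`. As `bᵢ^{pᵢ'}` is only in weak `L^{N/p̄}`, its pairing with `|u|^{p̄}` needs the
Lorentz embedding into `L^{p̄*, p̄}` and not merely into `L^{p̄*}`. The embedding is proved on
dyadic levels: `levelQ` at height `t` is `(t |{|u| ≥ t}|^{1/p̄*})^{p̄}`, and its sum over `t = 2^k`
is bounded through a recursion whose error terms are integrals of `|∂ᵢu|^{pᵢ}` over disjoint bands
(`exists_sum_levelQ_le`). -/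

noncomputable section

namespace Aniso

/-! ### Weak-type Gagliardo-Nirenberg inequality with weights -/

section

/-- A `C¹` compactly supported function is bounded by the integral of its partial derivative along
any coordinate line. -/
theorem enorm_le_lintegral_update {ι : Type*} [Fintype ι] [DecidableEq ι] {u : (ι → ℝ) → ℝ}
    (hu : ContDiff ℝ 1 u) (h2u : HasCompactSupport u) (x : ι → ℝ) (i : ι) :
    ‖u x‖ₑ ≤ ∫⁻ t, ‖fderiv ℝ u (Function.update x i t) (Pi.single i 1)‖ₑ := by
  calc ‖u x‖ₑ
    _ ≤ ∫⁻ t in Iic (x i), ‖deriv (u ∘ Function.update x i) t‖ₑ := by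
        apply le_trans (by simp) (HasCompactSupport.enorm_le_lintegral_Ici_deriv _ _ _)
        · exact hu.comp (by convert! contDiff_update 1 x i)
        · exact h2u.comp_isClosedEmbedding (isClosedEmbedding_update x i)
    _ ≤ ∫⁻ t, ‖deriv (u ∘ Function.update x i) t‖ₑ := setLIntegral_le_lintegral _ _
    _ = _ := by
        refine lintegral_congr fun t => ?_
        rw [fderiv_comp_deriv _ (hu.differentiable one_ne_zero).differentiableAt
          (hasDerivAt_update x i t).differentiableAt, (hasDerivAt_update x i t).deriv]

/-- A weak-type anisotropic Gagliardo-Nirenberg inequality with free weights. -/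
theorem measure_pow_mul_prod_le_pi {ι : Type*} [Fintype ι] [DecidableEq ι]
    (hι : 2 ≤ Fintype.card ι) {u : (ι → ℝ) → ℝ} (hu : ContDiff ℝ 1 u)
    (h2u : HasCompactSupport u) (c : ι → ℝ≥0∞) {S : Set (ι → ℝ)} (hS : ∀ x ∈ S, 1 ≤ ‖u x‖ₑ) :
    volume S ^ (Fintype.card ι - 1) * ∏ i, c i ≤
      (∑ i, c i * ∫⁻ x, ‖fderiv ℝ u x (Pi.single i 1)‖ₑ) ^ Fintype.card ι := by
  have hn : (2 : ℝ) ≤ Fintype.card ι := by exact_mod_cast hι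
  set n := (Fintype.card ι : ℝ)
  have hn1 : 0 < n - 1 := by linarith
  have hp : Real.HolderConjugate n (n / (n - 1)) := .conjExponent (by linarith)
  have hmeas : ∀ i, Measurable fun x => ‖fderiv ℝ u x (Pi.single i 1)‖ₑ := fun i =>
    ((hu.continuous_fderiv one_ne_zero).clm_apply continuous_const).enorm.measurable
  -- A single function dominating every weighted partial derivative, so that the grid-lines
  -- inequality for one integrand applies although the directions carry different weights.
  set f : (ι → ℝ) → ℝ≥0∞ := fun x => ∑ i, c i * ‖fderiv ℝ u x (Pi.single i 1)‖ₑ with hf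
  have hfm : Measurable f := by fun_prop
  have hint : ∫⁻ x, f x = ∑ i, c i * ∫⁻ x, ‖fderiv ℝ u x (Pi.single i 1)‖ₑ := by
    rw [hf, lintegral_finsetSum _ fun i _ => (hmeas i).const_mul _]
    exact Finset.sum_congr rfl fun i _ => lintegral_const_mul _ (hmeas i)
  -- Chebyshev's inequality for the product of the `(c i |u|)^{1/(n-1)}`, each factor bounded by a
  -- line integral of `f`; the Loomis-Whitney type inequality then integrates the product.
  have key : (∏ i, c i ^ (1 / (n - 1))) * volume S ≤ (∫⁻ x, f x) ^ (n / (n - 1)) := by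
    calc (∏ i, c i ^ (1 / (n - 1))) * volume S
        ≤ (∏ i, c i ^ (1 / (n - 1))) *
          volume {x | ∏ i, c i ^ (1 / (n - 1)) ≤ ∏ i, (c i * ‖u x‖ₑ) ^ (1 / (n - 1))} := by
          gcongr
          intro x hx
          refine Finset.prod_le_prod' fun i _ => ENNReal.rpow_le_rpow ?_ (by positivity)
          exact le_mul_of_one_le_right' (hS x hx)
      _ ≤ ∫⁻ x, ∏ i, (c i * ‖u x‖ₑ) ^ (1 / (n - 1)) := by
          refine mul_meas_ge_le_lintegral ?_ _
          have := hu.continuous.measurable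
          fun_prop
      _ ≤ ∫⁻ x, ∏ i, (∫⁻ t, f (Function.update x i t)) ^ (1 / (n - 1)) := by
          gcongr with x i
          refine (mul_le_mul_right (enorm_le_lintegral_update hu h2u x i) (c i)).trans ?_
          have hm : Measurable fun t =>
              ‖fderiv ℝ u (Function.update x i t) (Pi.single i 1)‖ₑ :=
            (hmeas i).comp (measurable_update x)
          rw [← lintegral_const_mul _ hm]
          refine lintegral_mono fun t => ?_
          exact Finset.single_le_sum (f := fun j =>
            c j * ‖fderiv ℝ u (Function.update x i t) (Pi.single j 1)‖ₑ)
            (fun _ _ => zero_le) (Finset.mem_univ i)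
      _ ≤ _ := lintegral_prod_lintegral_pow_le _ hp hfm
  rw [← hint]
  have h2 := ENNReal.rpow_le_rpow key hn1.le
  rw [← ENNReal.rpow_mul, div_mul_cancel₀ _ hn1.ne', ENNReal.mul_rpow_of_nonneg _ _ hn1.le,
    ENNReal.rpow_natCast] at h2
  have e1 : (∏ i, c i ^ (1 / (n - 1))) ^ (n - 1) = ∏ i, c i := by
    rw [← ENNReal.prod_rpow_of_nonneg hn1.le]
    refine Finset.prod_congr rfl fun i _ => ?_
    rw [← ENNReal.rpow_mul, one_div_mul_cancel hn1.ne', ENNReal.rpow_one]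
  have e2 : volume S ^ (n - 1) = volume S ^ (Fintype.card ι - 1) := by
    rw [← ENNReal.rpow_natCast, Nat.cast_sub (by omega), Nat.cast_one]
  rwa [e1, e2, mul_comm] at h2

/-- The weak-type anisotropic Gagliardo-Nirenberg inequality in Euclidean space. -/
theorem measure_pow_mul_prod_le {N : ℕ} (hN : 2 ≤ N) {u : EuclideanSpace ℝ (Fin N) → ℝ}
    (hu : ContDiff ℝ 1 u) (h2u : HasCompactSupport u) (c : Fin N → ℝ≥0∞)
    {S : Set (EuclideanSpace ℝ (Fin N))} (hSm : MeasurableSet S) (hS : ∀ x ∈ S, 1 ≤ ‖u x‖ₑ) :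
    volume S ^ (N - 1) * ∏ i, c i ≤
      (∑ i, c i * ∫⁻ x, ‖partialDeriv i u x‖ₑ) ^ N := by
  set e := (EuclideanSpace.equiv (Fin N) ℝ).symm with he
  have hmp : MeasurePreserving (e : (Fin N → ℝ) → EuclideanSpace ℝ (Fin N)) :=
    PiLp.volume_preserving_toLp (Fin N)
  have h := measure_pow_mul_prod_le_pi (ι := Fin N) (by simpa using hN) (u := u ∘ e)
    (hu.comp e.contDiff) (h2u.comp_homeomorph e.toHomeomorph) c (S := e ⁻¹' S) (fun x hx => hS _ hx)
  rw [hmp.measure_preimage hSm.nullMeasurableSet, Fintype.card_fin] at h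
  convert h using 5 with i
  rw [← hmp.lintegral_comp_emb e.toHomeomorph.measurableEmbedding]
  refine lintegral_congr fun x => ?_
  rw [fderiv_comp _ (hu.differentiable one_ne_zero _) e.differentiableAt]
  simp [partialDeriv, e.fderiv]
  rfl

end

/-! ### Exponents, cut-offs and the estimate between consecutive levels -/

section

section Exponents

variable {N : ℕ} {p : Fin N → ℝ}

theorem sum_inv_pos (hN : 0 < N) (hp : ∀ i, 1 < p i) : 0 < ∑ i, 1 / p i := by
  have : Nonempty (Fin N) := ⟨⟨0, hN⟩⟩
  exact Finset.sum_pos (fun i _ => one_div_pos.2 (by linarith [hp i])) Finset.univ_nonempty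

theorem harmonicMean_pos (hN : 0 < N) (hp : ∀ i, 1 < p i) : 0 < harmonicMean p := by
  have h1 := sum_inv_pos hN hp
  have h2 : (0 : ℝ) < N := by exact_mod_cast hN
  unfold harmonicMean
  positivity

theorem sum_inv_eq (hN : 0 < N) : ∑ i, 1 / p i = N / harmonicMean p := by
  have h2 : (0 : ℝ) < N := by exact_mod_cast hN
  unfold harmonicMean
  field_simp

/-- The smallest exponent is at most the harmonic mean. -/
theorem exists_le_harmonicMean (hN : 0 < N) (hp : ∀ i, 1 < p i) :
    ∃ i, p i ≤ harmonicMean p := by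
  by_contra! h
  have : Nonempty (Fin N) := ⟨⟨0, hN⟩⟩
  have hq := harmonicMean_pos hN hp
  have h1 : ∑ i, 1 / p i < ∑ _i : Fin N, 1 / harmonicMean p :=
    Finset.sum_lt_sum_of_nonempty Finset.univ_nonempty
      fun i _ => one_div_lt_one_div_of_lt hq (h i)
  rw [sum_inv_eq hN] at h1
  simp only [Finset.sum_const, Finset.card_univ, Fintype.card_fin, nsmul_eq_mul, mul_one_div] at h1
  exact lt_irrefl _ h1

end Exponents

/-- Young's inequality in the form `t ≤ δ + δ^{1-q} t^q`. -/
theorem le_add_rpow {q δ t : ℝ} (hq : 1 < q) (hδ : 0 < δ) (ht : 0 ≤ t) :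
    t ≤ δ + δ ^ (1 - q) * t ^ q := by
  rcases le_or_gt t δ with h | h
  · have := Real.rpow_nonneg ht q
    have := Real.rpow_nonneg hδ.le (1 - q)
    nlinarith [mul_nonneg this (Real.rpow_nonneg ht q)]
  · have ht' : 0 < t := hδ.trans h
    have h1 : t = t ^ (1 - q) * t ^ q := by
      rw [← Real.rpow_add ht']
      simp
    have h2 : t ^ (1 - q) ≤ δ ^ (1 - q) := Real.rpow_le_rpow_of_nonpos hδ h.le (by linarith)
    have h3 := mul_le_mul_of_nonneg_right h2 (Real.rpow_nonneg ht q)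
    linarith

/-- A smooth even cut-off, vanishing on `[-1, 1]` and equal to `1` off `(-2, 2)`. -/
def cutoff (s : ℝ) : ℝ := Real.smoothTransition (s ^ 2 - 1)

theorem contDiff_cutoff {n : ℕ∞} : ContDiff ℝ n cutoff :=
  Real.smoothTransition.contDiff.comp ((contDiff_id.pow 2).sub contDiff_const)

theorem cutoff_zero : cutoff 0 = 0 := Real.smoothTransition.zero_of_nonpos (by norm_num)

theorem cutoff_of_two_le {s : ℝ} (hs : 2 ≤ |s|) : cutoff s = 1 := by
  refine Real.smoothTransition.one_of_one_le ?_
  rw [← sq_abs]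
  nlinarith

theorem deriv_cutoff_of_lt {s : ℝ} (hs : |s| < 1) : deriv cutoff s = 0 := by
  have : cutoff =ᶠ[nhds s] fun _ => 0 := by
    filter_upwards [continuous_abs.continuousAt.eventually_lt continuousAt_const hs] with y hy
    refine Real.smoothTransition.zero_of_nonpos ?_
    rw [← sq_abs]
    nlinarith [abs_nonneg y]
  rw [this.deriv_eq, deriv_const]

theorem deriv_cutoff_of_ge {s : ℝ} (hs : 2 ≤ |s|) : deriv cutoff s = 0 := by
  have h2 : (3 / 2 : ℝ) < |s| := by linarith
  have : cutoff =ᶠ[nhds s] fun _ => 1 := by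
    filter_upwards [continuousAt_const.eventually_lt continuous_abs.continuousAt h2] with y hy
    refine Real.smoothTransition.one_of_one_le ?_
    rw [← sq_abs]
    nlinarith [abs_nonneg y]
  rw [this.deriv_eq, deriv_const]

theorem exists_deriv_cutoff_le : ∃ C : ℝ, 0 < C ∧ ∀ s, |deriv cutoff s| ≤ C := by
  have hc : Continuous (deriv cutoff) := (contDiff_cutoff (n := 1)).continuous_deriv le_rfl
  obtain ⟨C, hC⟩ := (isCompact_Icc (a := (-2 : ℝ)) (b := 2)).exists_bound_of_continuousOn
    hc.continuousOn
  refine ⟨max C 1, by positivity, fun s => ?_⟩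
  by_cases hs : s ∈ Icc (-2 : ℝ) 2
  · exact (hC s hs).trans (le_max_left _ _)
  · rw [deriv_cutoff_of_ge, abs_zero]
    · positivity
    · by_contra! h
      exact hs ⟨(abs_lt.1 h).1.le, (abs_lt.1 h).2.le⟩

/-- Chain rule for partial derivatives. -/
theorem partialDeriv_comp {N : ℕ} {u : EuclideanSpace ℝ (Fin N) → ℝ} {H : ℝ → ℝ}
    (hu : Differentiable ℝ u) (hH : Differentiable ℝ H) (i : Fin N)
    (x : EuclideanSpace ℝ (Fin N)) :
    partialDeriv i (fun y => H (u y)) x = deriv H (u x) * partialDeriv i u x := by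
  unfold partialDeriv
  have := fderiv_comp x (hH (u x)) (hu x)
  rw [show (fun y => H (u y)) = H ∘ u from rfl, this]
  simp [mul_comm]

/-- The quantity controlling the superlevel set of `u` of height `t` in the Lorentz space
`L^{p̄*, p̄}`. -/
def levelQ {N : ℕ} (q : ℝ) (u : EuclideanSpace ℝ (Fin N) → ℝ) (t : ℝ) : ℝ :=
  t ^ q * (volume {x | t ≤ |u x|}).toReal ^ (1 - q / N)

theorem levelQ_nonneg {N : ℕ} (q : ℝ) (u : EuclideanSpace ℝ (Fin N) → ℝ) {t : ℝ} (ht : 0 ≤ t) :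
    0 ≤ levelQ q u t := by
  unfold levelQ
  positivity

section Level

variable {N : ℕ} {u : EuclideanSpace ℝ (Fin N) → ℝ}

theorem volume_superlevel_lt_top (h2u : HasCompactSupport u) {t : ℝ}
    (ht : 0 < t) : volume {x | t ≤ |u x|} < ∞ := by
  refine (measure_mono fun x hx => ?_).trans_lt h2u.isCompact.measure_lt_top
  refine subset_tsupport _ fun h => ?_
  simp only [mem_ofPred_eq, h, abs_zero] at hx
  linarith

theorem continuous_partialDeriv_of_contDiff (hu : ContDiff ℝ 1 u) (i : Fin N) :
    Continuous (partialDeriv i u) :=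
  (hu.continuous_fderiv one_ne_zero).clm_apply continuous_const

theorem integrable_partialDeriv_rpow (hu : ContDiff ℝ 1 u) (h2u : HasCompactSupport u) (i : Fin N)
    {q : ℝ} (hq : 0 < q) : Integrable (fun x => |partialDeriv i u x| ^ q) := by
  refine Continuous.integrable_of_hasCompactSupport
    ((continuous_partialDeriv_of_contDiff hu i).abs.rpow_const fun _ => .inr hq.le) ?_
  exact (h2u.fderiv_apply ℝ (EuclideanSpace.single i 1)).comp_left
    (g := fun s => |s| ^ q) (by simp [hq.ne'])

/-- The weak-type inequality between two consecutive dyadic levels. -/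
theorem superlevel_le (hN : 2 ≤ N) {p : Fin N → ℝ} (hp : ∀ i, 1 < p i) {C : ℝ} (hC : 0 < C)
    (hCd : ∀ s, |deriv cutoff s| ≤ C) (hu : ContDiff ℝ 1 u) (h2u : HasCompactSupport u) {t : ℝ}
    (ht : 0 < t) {δ ν : ℝ} (hδ : 0 < δ) (hν : 0 < ν) :
    (volume {x | 2 * t ≤ |u x|}).toReal ^ (N - 1) * ∏ i, (t * ν ^ (1 / p i)) ≤
      (∑ i, C * (δ * (volume {x | t ≤ |u x|}).toReal + δ ^ (1 - p i) * (ν *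
        ∫ x in {x | t ≤ |u x| ∧ |u x| < 2 * t}, |partialDeriv i u x| ^ p i))) ^ N := by
  set D := {x | t ≤ |u x| ∧ |u x| < 2 * t} with hD
  have huc := hu.continuous
  have hDm : MeasurableSet D :=
    (measurableSet_le measurable_const huc.abs.measurable).inter
      (measurableSet_lt huc.abs.measurable measurable_const)
  have hfin := volume_superlevel_lt_top h2u ht
  have hDsub : D ⊆ {x | t ≤ |u x|} := fun x hx => hx.1
  have hDfin : volume D < ∞ := (measure_mono hDsub).trans_lt hfin
  -- The cut-off localises: `w = 1` where `|u| ≥ 2t`, and the gradient of `w` vanishes off the band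
  -- `D`.
  set w : EuclideanSpace ℝ (Fin N) → ℝ := fun x => cutoff (u x / t) with hw
  have hw1 : ContDiff ℝ 1 w := (contDiff_cutoff (n := 1)).comp (hu.div_const t)
  have hw2 : HasCompactSupport w :=
    h2u.comp_left (g := fun s => cutoff (s / t)) (by simp [cutoff_zero])
  have hpd : ∀ i x, partialDeriv i w x = deriv cutoff (u x / t) * (t⁻¹ * partialDeriv i u x) := by
    intro i x
    rw [hw, partialDeriv_comp (u := fun x => u x / t)
      ((hu.div_const t).differentiable one_ne_zero)
      ((contDiff_cutoff (n := 1)).differentiable one_ne_zero)]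
    congr 1
    have := partialDeriv_comp (H := fun s => s / t) (hu.differentiable one_ne_zero)
      (differentiable_id.div_const t) i x
    rw [this]
    simp [div_eq_mul_inv]
  -- In the weight `t ν^{1/pᵢ}` the factor `t` cancels the `1/t` of the chain rule, and Young's
  -- inequality with exponent `pᵢ` turns `ν^{1/pᵢ}` into the same factor `ν` in all directions.
  have hle : ∀ i x, |t * ν ^ (1 / p i) * partialDeriv i w x| ≤
      D.indicator (fun x => C * (δ + δ ^ (1 - p i) * (ν * |partialDeriv i u x| ^ p i))) x := by
    intro i x
    have hν' : 0 < ν ^ (1 / p i) := Real.rpow_pos_of_pos hν _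
    rw [hpd]
    by_cases hx : x ∈ D
    · rw [indicator_of_mem hx]
      have e : t * ν ^ (1 / p i) * (deriv cutoff (u x / t) * (t⁻¹ * partialDeriv i u x)) =
        deriv cutoff (u x / t) * (ν ^ (1 / p i) * partialDeriv i u x) := by
        field_simp
      rw [e, abs_mul, abs_mul, abs_of_pos hν']
      have hy := le_add_rpow (hp i) hδ (t := ν ^ (1 / p i) * |partialDeriv i u x|) (by positivity)
      rw [Real.mul_rpow hν'.le (abs_nonneg _), ← Real.rpow_mul hν.le,
        one_div_mul_cancel (by linarith [hp i]), Real.rpow_one] at hy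
      exact mul_le_mul (hCd _) hy (by positivity) hC.le
    · have h0 : deriv cutoff (u x / t) = 0 := by
        simp only [hD, mem_ofPred_eq, not_and, not_lt] at hx
        rcases lt_or_ge |u x| t with h | h
        · refine deriv_cutoff_of_lt ?_
          rwa [abs_div, abs_of_pos ht, div_lt_one ht]
        · refine deriv_cutoff_of_ge ?_
          rw [abs_div, abs_of_pos ht, le_div_iff₀ ht]
          exact hx h
      rw [indicator_of_notMem hx, h0]
      simp
  have hint : ∀ i, IntegrableOn (fun x => |partialDeriv i u x| ^ p i) D := fun i =>
    (integrable_partialDeriv_rpow hu h2u i (by linarith [hp i])).integrableOn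
  have hI : ∀ i, ENNReal.ofReal (t * ν ^ (1 / p i)) * ∫⁻ x, ‖partialDeriv i w x‖ₑ ≤
      ENNReal.ofReal (C * (δ * (volume {x | t ≤ |u x|}).toReal + δ ^ (1 - p i) * (ν *
        ∫ x in D, |partialDeriv i u x| ^ p i))) := by
    intro i
    have hint2 : IntegrableOn
        (fun x => C * (δ + δ ^ (1 - p i) * (ν * |partialDeriv i u x| ^ p i))) D :=
      (Integrable.add (integrableOn_const hDfin.ne)
        (((hint i).const_mul _).const_mul _)).const_mul C
    calc ENNReal.ofReal (t * ν ^ (1 / p i)) * ∫⁻ x, ‖partialDeriv i w x‖ₑ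
        = ∫⁻ x, ‖t * ν ^ (1 / p i) * partialDeriv i w x‖ₑ := by
          rw [← lintegral_const_mul _
            (continuous_partialDeriv_of_contDiff hw1 i).enorm.measurable]
          refine lintegral_congr fun x => ?_
          rw [enorm_mul, Real.enorm_of_nonneg (r := t * ν ^ (1 / p i)) (by positivity)]
      _ ≤ ∫⁻ x, D.indicator (fun x => ENNReal.ofReal
          (C * (δ + δ ^ (1 - p i) * (ν * |partialDeriv i u x| ^ p i)))) x := by
          refine lintegral_mono fun x => ?_
          have := hle i x
          rw [Real.enorm_eq_ofReal_abs]
          refine (ENNReal.ofReal_le_ofReal this).trans ?_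
          by_cases hx : x ∈ D <;> simp [hx]
      _ = ENNReal.ofReal (∫ x in D,
          C * (δ + δ ^ (1 - p i) * (ν * |partialDeriv i u x| ^ p i))) := by
          rw [lintegral_indicator hDm, ofReal_integral_eq_lintegral_ofReal hint2]
          exact .of_forall fun x => by positivity
      _ ≤ _ := by
          refine ENNReal.ofReal_le_ofReal ?_
          have h1 : IntegrableOn (fun _ : EuclideanSpace ℝ (Fin N) => δ) D :=
            integrableOn_const hDfin.ne
          rw [integral_const_mul, integral_add h1 (((hint i).const_mul _).const_mul _),
            integral_const_mul, integral_const_mul, setIntegral_const, smul_eq_mul, mul_comm _ δ]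
          have : volume.real D ≤ (volume {x | t ≤ |u x|}).toReal :=
            ENNReal.toReal_mono hfin.ne (measure_mono hDsub)
          gcongr
  have hmain := measure_pow_mul_prod_le hN hw1 hw2 (fun i => ENNReal.ofReal (t * ν ^ (1 / p i)))
    (S := {x | 2 * t ≤ |u x|}) (measurableSet_le measurable_const huc.abs.measurable) (by
      intro x hx
      have : w x = 1 := by
        refine cutoff_of_two_le ?_
        rw [abs_div, abs_of_pos ht, le_div_iff₀ ht]
        exact hx
      rw [this]
      simp)
  have hnn : ∀ i, 0 ≤ C * (δ * (volume {x | t ≤ |u x|}).toReal + δ ^ (1 - p i) * (ν *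
        ∫ x in D, |partialDeriv i u x| ^ p i)) := by
    intro i
    have : 0 ≤ ∫ x in D, |partialDeriv i u x| ^ p i := integral_nonneg fun x => by positivity
    positivity
  have h3 := hmain.trans (pow_le_pow_left₀ zero_le (Finset.sum_le_sum fun i _ => hI i) N)
  rw [← ENNReal.ofReal_sum_of_nonneg fun i _ => hnn i,
    ← ENNReal.ofReal_pow (Finset.sum_nonneg fun i _ => hnn i),
    ← ENNReal.ofReal_prod_of_nonneg fun i _ => by positivity] at h3
  have h4 := ENNReal.toReal_mono ENNReal.ofReal_ne_top h3
  rwa [ENNReal.toReal_mul, ENNReal.toReal_pow, ENNReal.toReal_ofReal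
    (Finset.prod_nonneg fun i _ => by positivity), ENNReal.toReal_ofReal
    (pow_nonneg (Finset.sum_nonneg fun i _ => hnn i) N)] at h4

end Level

end

/-! ### Dyadic summation: the Lorentz-Sobolev bound for smooth functions -/

section

variable {N : ℕ}

/-- Recursive estimate of `levelQ` on dyadic levels. -/
theorem exists_levelQ_two_mul_le (hN : 2 ≤ N) {p : Fin N → ℝ} (hp : ∀ i, 1 < p i)
    (hpN : harmonicMean p < N) :
    ∃ K : ℝ, 0 ≤ K ∧ ∀ u : EuclideanSpace ℝ (Fin N) → ℝ, ContDiff ℝ 1 u → HasCompactSupport u →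
      ∀ t : ℝ, 0 < t → levelQ (harmonicMean p) u (2 * t) ≤
        levelQ (harmonicMean p) u t / 2 + K *
          ∑ i, ∫ x in {x | t ≤ |u x| ∧ |u x| < 2 * t}, |partialDeriv i u x| ^ p i := by
  obtain ⟨C, hC, hCd⟩ := exists_deriv_cutoff_le
  have hN0 : (0 : ℝ) < N := by exact_mod_cast (by omega : 0 < N)
  set q := harmonicMean p with hq
  have hq0 : 0 < q := harmonicMean_pos (by omega) hp
  -- `σ = p̄ / p̄*`.
  set σ : ℝ := 1 - q / N with hσ
  have hσ0 : 0 < σ := by rw [hσ, sub_pos, div_lt_one hN0]; exact hpN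
  -- Chosen so that `2^q η^σ = 1/2`: if the measure drops at least by the factor `η` between `t` and
  -- `2t`, then `levelQ` halves.
  set η : ℝ := (2 : ℝ) ^ (-(q + 1) / σ) with hη
  have hη0 : 0 < η := by positivity
  have hησ : (2 : ℝ) ^ q * η ^ σ = 1 / 2 := by
    rw [hη, ← Real.rpow_mul (by norm_num), div_mul_cancel₀ _ hσ0.ne',
      ← Real.rpow_add (by norm_num)]
    rw [show q + -(q + 1) = -1 by ring, Real.rpow_neg_one]
    norm_num
  -- Makes `C N δ m = η m / 2`, which is absorbed by `m'` when `η m < m'`.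
  set δ : ℝ := η / (2 * C * N) with hδ
  have hδ0 : 0 < δ := by positivity
  set M : ℝ := ∑ i, δ ^ (1 - p i) with hM
  have hMi : ∀ i, δ ^ (1 - p i) ≤ M := fun i =>
    Finset.single_le_sum (f := fun i => δ ^ (1 - p i)) (fun j _ => by positivity)
      (Finset.mem_univ i)
  have hM0 : 0 ≤ M := Finset.sum_nonneg fun i _ => by positivity
  refine ⟨2 ^ q * (2 * C * M), by positivity, fun u hu h2u t ht => ?_⟩
  set m := (volume {x | t ≤ |u x|}).toReal with hm
  set m' := (volume {x | 2 * t ≤ |u x|}).toReal with hm'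
  set a : Fin N → ℝ := fun i =>
    ∫ x in {x | t ≤ |u x| ∧ |u x| < 2 * t}, |partialDeriv i u x| ^ p i with ha
  have ha0 : ∀ i, 0 ≤ a i := fun i => integral_nonneg fun x => by positivity
  have hS0 : 0 ≤ ∑ i, a i := Finset.sum_nonneg fun i _ => ha0 i
  have hm0 : 0 ≤ m := ENNReal.toReal_nonneg
  have hm'0 : 0 ≤ m' := ENNReal.toReal_nonneg
  have htq : 0 < t ^ q := Real.rpow_pos_of_pos ht q
  have e2 : (2 * t) ^ q = 2 ^ q * t ^ q := Real.mul_rpow (by norm_num) ht.le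
  change (2 * t) ^ q * m' ^ σ ≤ t ^ q * m ^ σ / 2 + 2 ^ q * (2 * C * M) * ∑ i, a i
  rw [e2]
  have hX : 0 ≤ t ^ q * m ^ σ := by positivity
  rcases le_or_gt m' (η * m) with h | h
  · have h1 : m' ^ σ ≤ η ^ σ * m ^ σ := by
      rw [← Real.mul_rpow hη0.le hm0]
      exact Real.rpow_le_rpow hm'0 h hσ0.le
    have h2 : 2 ^ q * t ^ q * m' ^ σ ≤ 2 ^ q * t ^ q * (η ^ σ * m ^ σ) := by gcongr
    have h3 : 2 ^ q * t ^ q * (η ^ σ * m ^ σ) = t ^ q * m ^ σ / 2 := by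
      rw [show 2 ^ q * t ^ q * (η ^ σ * m ^ σ) = (2 ^ q * η ^ σ) * (t ^ q * m ^ σ) by ring, hησ]
      ring
    have : 0 ≤ 2 ^ q * (2 * C * M) * ∑ i, a i := by positivity
    linarith
  · have hm'p : 0 < m' := lt_of_le_of_lt (by positivity) h
    -- Since `∑ 1/pᵢ = N/q`, the product of the weights is `t^N ν^{N/q}`. This choice makes it equal
    -- to `m'`, so the left side becomes `m'^N` and an `N`-th root can be taken; moreover `m'/ν =
    -- t^q m'^σ` is the quantity to estimate.
    set ν : ℝ := m' ^ (q / N) / t ^ q with hν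
    have hν0 : 0 < ν := by positivity
    have hmain := superlevel_le hN hp hC hCd hu h2u ht hδ0 hν0
    have hprod : ∏ i, (t * ν ^ (1 / p i)) = m' := by
      rw [Finset.prod_mul_distrib, Finset.prod_const, Finset.card_univ, Fintype.card_fin,
        ← Real.rpow_sum_of_pos hν0, sum_inv_eq (by omega), ← hq, hν,
        Real.div_rpow (by positivity) (by positivity), ← Real.rpow_mul hm'0, ← Real.rpow_mul ht.le]
      rw [show q / N * (N / q) = 1 by field_simp, show q * (N / q) = N by field_simp,
        Real.rpow_one, Real.rpow_natCast]
      field_simp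
    rw [hprod, ← hm', ← pow_succ, Nat.sub_add_cancel (by omega)] at hmain
    have h1 := le_of_pow_le_pow_left₀ (by omega : N ≠ 0)
      (Finset.sum_nonneg fun i _ => by have := ha0 i; positivity) hmain
    have h2 : ∑ i, C * (δ * m + δ ^ (1 - p i) * (ν * a i)) ≤
        C * N * δ * m + C * M * ν * ∑ i, a i := by
      have : ∀ i ∈ Finset.univ, C * (δ * m + δ ^ (1 - p i) * (ν * a i)) ≤
          C * δ * m + C * M * ν * a i := by
        intro i _
        have h3 : δ ^ (1 - p i) * (ν * a i) ≤ M * (ν * a i) :=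
          mul_le_mul_of_nonneg_right (hMi i) (mul_nonneg hν0.le (ha0 i))
        calc C * (δ * m + δ ^ (1 - p i) * (ν * a i)) ≤ C * (δ * m + M * (ν * a i)) := by gcongr
          _ = _ := by ring
      refine (Finset.sum_le_sum this).trans (le_of_eq ?_)
      simp only [Finset.sum_add_distrib, Finset.mul_sum, Finset.sum_const, Finset.card_univ,
        Fintype.card_fin, nsmul_eq_mul]
      ring
    have h3 : C * N * δ * m ≤ m' / 2 := by
      have : C * N * δ = η / 2 := by rw [hδ]; field_simp
      rw [this]
      linarith
    have h4 : m' ≤ 2 * C * M * ν * ∑ i, a i := by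
      have := h1.trans h2
      linarith
    have h5 : 2 ^ q * t ^ q * m' ^ σ = 2 ^ q * (m' / ν) := by
      rw [hν, hσ, Real.rpow_sub hm'p, Real.rpow_one]
      field_simp
    rw [h5]
    have h6 : m' / ν ≤ 2 * C * M * ∑ i, a i := by
      rw [div_le_iff₀ hν0]
      linarith
    have : 2 ^ q * (m' / ν) ≤ 2 ^ q * (2 * C * M * ∑ i, a i) := by gcongr
    linarith

/-- The anisotropic Sobolev embedding into `L^{p̄*, p̄}`, for `C¹` functions with compact support:
summability over dyadic levels. -/
theorem exists_sum_levelQ_le (hN : 2 ≤ N) {p : Fin N → ℝ} (hp : ∀ i, 1 < p i)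
    (hpN : harmonicMean p < N) :
    ∃ K : ℝ, 0 ≤ K ∧ ∀ u : EuclideanSpace ℝ (Fin N) → ℝ, ContDiff ℝ 1 u → HasCompactSupport u →
      ∀ n : ℕ, ∑ k ∈ Finset.range n, levelQ (harmonicMean p) u (2 ^ k) ≤
        2 * levelQ (harmonicMean p) u 1 + K * ∑ i, ∫ x, |partialDeriv i u x| ^ p i := by
  obtain ⟨K, hK, h⟩ := exists_levelQ_two_mul_le hN hp hpN
  refine ⟨2 * K, by positivity, fun u hu h2u n => ?_⟩
  set X : ℕ → ℝ := fun k => levelQ (harmonicMean p) u (2 ^ k) with hX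
  set D : ℕ → Set (EuclideanSpace ℝ (Fin N)) := fun k => {x | 2 ^ k ≤ |u x| ∧ |u x| < 2 * 2 ^ k}
    with hD
  have hX0 : ∀ k, 0 ≤ X k := fun k => levelQ_nonneg _ _ (by positivity)
  have hDm : ∀ k, MeasurableSet (D k) := fun k =>
    (measurableSet_le measurable_const hu.continuous.abs.measurable).inter
      (measurableSet_lt hu.continuous.abs.measurable measurable_const)
  have hdisj : Pairwise fun j k => Disjoint (D j) (D k) := by
    have : ∀ j k, j < k → Disjoint (D j) (D k) := by
      intro j k hjk
      refine disjoint_left.2 fun x hx hy => ?_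
      have h1 : (2 : ℝ) * 2 ^ j ≤ 2 ^ k := by
        rw [← pow_succ']
        exact pow_le_pow_right₀ (by norm_num) hjk
      linarith [hx.2, hy.1]
    intro j k hjk
    rcases lt_or_gt_of_ne hjk with h | h
    · exact this j k h
    · exact (this k j h).symm
  have hsum : ∀ i, ∑ k ∈ Finset.range n, ∫ x in D k, |partialDeriv i u x| ^ p i ≤
      ∫ x, |partialDeriv i u x| ^ p i := by
    intro i
    have hint := integrable_partialDeriv_rpow hu h2u i (q := p i) (by linarith [hp i])
    rw [← integral_biUnion_finset _ (fun k _ => hDm k) (fun j _ k _ hjk => hdisj hjk)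
      fun k _ => hint.integrableOn]
    exact setIntegral_le_integral hint (.of_forall fun x => by positivity)
  -- The recursion summed over `k`. Half of the sum is absorbed on the left, which leaves the first
  -- term `X 0` and the integrals over disjoint bands, both with a factor `2`.
  have hstep : ∀ n, ∑ k ∈ Finset.range n, X (k + 1) ≤ (∑ k ∈ Finset.range n, X k) / 2 +
      K * ∑ i, ∑ k ∈ Finset.range n, ∫ x in D k, |partialDeriv i u x| ^ p i := by
    intro n
    rw [Finset.sum_comm, Finset.mul_sum, Finset.sum_div, ← Finset.sum_add_distrib]
    refine Finset.sum_le_sum fun k _ => ?_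
    have := h u hu h2u (2 ^ k) (by positivity)
    rw [← pow_succ'] at this
    simpa only [hX, hD, ← pow_succ'] using this
  have h1 := hstep n
  have h2 : K * ∑ i, ∑ k ∈ Finset.range n, ∫ x in D k, |partialDeriv i u x| ^ p i ≤
      K * ∑ i, ∫ x, |partialDeriv i u x| ^ p i :=
    mul_le_mul_of_nonneg_left (Finset.sum_le_sum fun i _ => hsum i) hK
  have h3 : ∑ k ∈ Finset.range n, X k + X n = ∑ k ∈ Finset.range n, X (k + 1) + X 0 := by
    rw [← Finset.sum_range_succ, Finset.sum_range_succ']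
  have h4 : X 0 = levelQ (harmonicMean p) u 1 := by simp [hX]
  have := hX0 n
  rw [← h4]
  linarith

end

/-! ### Weak Lebesgue weights and uniform bounds for test functions -/

section

variable {N : ℕ} {Ω : Opens (EuclideanSpace ℝ (Fin N))}

/-- Functions in a weak Lebesgue space have small integrals on small sets. -/
theorem MemWeakLp.exists_setLIntegral_le {b : EuclideanSpace ℝ (Fin N) → ℝ} {r s : ℝ}
    (hb : MemWeakLp Ω b r) (hs : 0 < s) (hsr : s < r) :
    ∃ K : ℝ≥0∞, K ≠ ∞ ∧ ∀ E : Set (EuclideanSpace ℝ (Fin N)), volume E ≠ ∞ →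
      ∫⁻ x in E, ENNReal.ofReal (|b x| ^ s) ∂(volume.restrict (Ω : Set _)) ≤
        K * ENNReal.ofReal ((volume E).toReal ^ (1 - s / r)) := by
  have hr : 0 < r := hs.trans hsr
  have hrs : 1 < r / s := by rwa [one_lt_div hs]
  set K₀ := ⨆ t ∈ Ioi (0 : ℝ), ENNReal.ofReal (t ^ r) * volume {x | x ∈ Ω ∧ t < |b x|} with hK₀
  have hK₀fin : K₀ < ∞ := hb.2
  refine ⟨1 + K₀ * ENNReal.ofReal (1 / (r / s - 1)), by finiteness, fun E hE => ?_⟩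
  set μ := (volume.restrict (Ω : Set (EuclideanSpace ℝ (Fin N)))).restrict E with hμ
  set v := (volume E).toReal with hv
  have hμE : ∀ S, μ S ≤ volume E := fun S =>
    calc μ S ≤ μ univ := measure_mono (subset_univ _)
      _ = volume.restrict (Ω : Set (EuclideanSpace ℝ (Fin N))) E := by simp [hμ]
      _ ≤ volume E := Measure.restrict_apply_le _ _
  -- The threshold below is a negative power of the measure of `E`, so null sets are treated apart.
  rcases eq_or_ne (volume E) 0 with h0 | h0
  · have : μ = 0 := by
      rw [← Measure.measure_univ_eq_zero]
      exact le_antisymm (h0 ▸ hμE univ) zero_le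
    rw [this]
    simp
  have hv0 : 0 < v := ENNReal.toReal_pos h0 hE
  -- Threshold balancing the two halves of the layer-cake integral: the trivial bound `|E|` for `τ ≤
  -- T` gives `v T`, the weak-type tail for `τ > T` gives a multiple of `T^{1 - r/s}`, and both
  -- powers equal `v^{1 - s/r}`.
  set T : ℝ := v ^ (-(s / r)) with hT
  have hT0 : 0 < T := Real.rpow_pos_of_pos hv0 _
  have hm : AEMeasurable (fun x => |b x| ^ s) μ :=
    ((continuous_abs.measurable.comp_aemeasurable hb.1).pow_const s).restrict
  have htail : ∀ τ ∈ Ioi T, μ {x | τ < |b x| ^ s} ≤ K₀ * ENNReal.ofReal (τ ^ (-(r / s))) := by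
    intro τ hτ
    have hτ0 : 0 < τ := hT0.trans hτ
    have h1 : ENNReal.ofReal ((τ ^ (1 / s)) ^ r) * volume {x | x ∈ Ω ∧ τ ^ (1 / s) < |b x|} ≤ K₀ :=
      le_iSup₂ (f := fun (t : ℝ) (_ : t ∈ Ioi (0 : ℝ)) =>
        ENNReal.ofReal (t ^ r) * volume {x | x ∈ Ω ∧ t < |b x|}) (τ ^ (1 / s))
        (Real.rpow_pos_of_pos hτ0 _)
    have h2 : μ {x | τ < |b x| ^ s} ≤ volume {x | x ∈ Ω ∧ τ ^ (1 / s) < |b x|} := by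
      refine (Measure.restrict_apply_le _ _).trans ?_
      rw [Measure.restrict_apply' Ω.isOpen.measurableSet]
      refine measure_mono fun x hx => ⟨hx.2, ?_⟩
      have := Real.rpow_lt_rpow hτ0.le hx.1 (one_div_pos.2 hs)
      rwa [← Real.rpow_mul (abs_nonneg _), mul_one_div_cancel hs.ne', Real.rpow_one] at this
    refine h2.trans ?_
    rw [Real.rpow_neg hτ0.le, ENNReal.ofReal_inv_of_pos (by positivity), ← div_eq_mul_inv,
      ENNReal.le_div_iff_mul_le (.inl (by simpa using by positivity)) (.inl ENNReal.ofReal_ne_top),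
      mul_comm]
    rwa [← Real.rpow_mul hτ0.le, one_div_mul_eq_div] at h1
  have e1 : ENNReal.ofReal v = volume E := ENNReal.ofReal_toReal hE
  have hvT : v * T = v ^ (1 - s / r) := by
    rw [hT, sub_eq_add_neg, Real.rpow_add hv0, Real.rpow_one]
  have hTT : T ^ (-(r / s) + 1) = v ^ (1 - s / r) := by
    rw [hT, ← Real.rpow_mul hv0.le]
    congr 1
    field_simp
    ring
  rw [lintegral_eq_lintegral_meas_lt μ (.of_forall fun x => by positivity) hm,
    ← Ioc_union_Ioi_eq_Ioi hT0.le, lintegral_union measurableSet_Ioi Ioc_disjoint_Ioi_same,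
    add_mul, one_mul]
  refine add_le_add ?_ ?_
  · calc ∫⁻ τ in Ioc 0 T, μ {x | τ < |b x| ^ s} ≤ ∫⁻ _ in Ioc 0 T, volume E :=
          lintegral_mono fun τ => hμE _
      _ = ENNReal.ofReal (v ^ (1 - s / r)) := by
          rw [setLIntegral_const, Real.volume_Ioc, sub_zero, ← e1, ← ENNReal.ofReal_mul hv0.le, hvT]
  · calc ∫⁻ τ in Ioi T, μ {x | τ < |b x| ^ s}
        ≤ ∫⁻ τ in Ioi T, K₀ * ENNReal.ofReal (τ ^ (-(r / s))) :=
          setLIntegral_mono' measurableSet_Ioi htail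
      _ = K₀ * ENNReal.ofReal (1 / (r / s - 1) * v ^ (1 - s / r)) := by
          rw [lintegral_const_mul _ (by fun_prop),
            ← ofReal_integral_eq_lintegral_ofReal (integrableOn_Ioi_rpow_of_lt (by linarith) hT0),
            integral_Ioi_rpow_of_lt (by linarith) hT0, hTT]
          · congr 2
            rw [show -(r / s) + 1 = -(r / s - 1) by ring, neg_div_neg_eq]
            ring
          · refine (ae_restrict_iff' measurableSet_Ioi).2 (.of_forall fun τ hτ => ?_)
            exact Real.rpow_nonneg (hT0.trans hτ).le _
      _ ≤ _ := by
          rw [ENNReal.ofReal_mul (by have : 0 < r / s - 1 := by linarith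
                                     positivity), mul_assoc]

theorem MemWeakLp.lintegral_ne_top {b : EuclideanSpace ℝ (Fin N) → ℝ} {r s : ℝ}
    (hb : MemWeakLp Ω b r) (hs : 0 < s) (hsr : s < r)
    (hΩ : volume (Ω : Set (EuclideanSpace ℝ (Fin N))) ≠ ∞) :
    ∫⁻ x in Ω, ENNReal.ofReal (|b x| ^ s) ≠ ∞ := by
  obtain ⟨K, hK, hKb⟩ := hb.exists_setLIntegral_le hs hsr
  have := hKb Ω hΩ
  rw [Measure.restrict_restrict Ω.isOpen.measurableSet, inter_self] at this
  exact (this.trans_lt (by finiteness)).ne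

/-- Dyadic decomposition of a weighted integral of a power. -/
theorem lintegral_mul_rpow_le_tsum {α : Type*} [MeasurableSpace α] {μ : Measure α}
    {h : α → ℝ≥0∞} {u : α → ℝ} (hh : AEMeasurable h μ) (hu : Measurable u) {r : ℝ} (hr : 0 ≤ r) :
    ∫⁻ x, h x * ENNReal.ofReal (|u x| ^ r) ∂μ ≤ ∫⁻ x, h x ∂μ +
      ∑' k : ℕ, ENNReal.ofReal ((2 * 2 ^ k) ^ r) * ∫⁻ x in {x | 2 ^ k ≤ |u x|}, h x ∂μ := by
  have hS : ∀ k : ℕ, MeasurableSet {x | (2 : ℝ) ^ k ≤ |u x|} := fun k =>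
    measurableSet_le measurable_const (continuous_abs.measurable.comp hu)
  have e : ∀ k : ℕ, ENNReal.ofReal ((2 * 2 ^ k) ^ r) * ∫⁻ x in {x | 2 ^ k ≤ |u x|}, h x ∂μ =
      ∫⁻ x, ENNReal.ofReal ((2 * 2 ^ k) ^ r) * {x | 2 ^ k ≤ |u x|}.indicator h x ∂μ := by
    intro k
    rw [lintegral_const_mul'' _ (hh.indicator (hS k)), lintegral_indicator (hS k)]
  simp_rw [e]
  rw [← lintegral_tsum fun k => (hh.indicator (hS k)).const_mul _, ← lintegral_add_left' hh]
  refine lintegral_mono fun x => ?_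
  rcases lt_or_ge |u x| 1 with h1 | h1
  · refine le_trans ?_ le_self_add
    refine mul_le_of_le_one_right' ?_
    exact ENNReal.ofReal_le_one.2 (Real.rpow_le_one (abs_nonneg _) h1.le hr)
  -- Only the term of the band `2^k ≤ |u| < 2^{k+1}` containing `x` is needed. The full superlevel
  -- sets in the sum are a harmless overcount.
  · obtain ⟨k, hk1, hk2⟩ := exists_nat_pow_near h1 (by norm_num : (1 : ℝ) < 2)
    refine le_trans ?_ le_add_self
    refine le_trans ?_ (ENNReal.le_tsum k)
    rw [indicator_of_mem (show x ∈ {x | (2 : ℝ) ^ k ≤ |u x|} from hk1), mul_comm]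
    gcongr
    rw [← pow_succ']
    exact hk2.le

/-- A weighted integral of a power is controlled by the sum of `levelQ` over dyadic levels. -/
theorem lintegral_mul_rpow_le_of_levelQ {μ : Measure (EuclideanSpace ℝ (Fin N))}
    {h : EuclideanSpace ℝ (Fin N) → ℝ≥0∞} {u : EuclideanSpace ℝ (Fin N) → ℝ}
    (hh : AEMeasurable h μ) (hu : Measurable u) {q r S : ℝ} (hr : 0 ≤ r) {K : ℝ≥0∞}
    (hS : ∀ n : ℕ, ∑ k ∈ Finset.range n, levelQ q u (2 ^ k) ≤ S)
    (hK : ∀ k : ℕ, ENNReal.ofReal ((2 ^ k) ^ r) * ∫⁻ x in {x | 2 ^ k ≤ |u x|}, h x ∂μ ≤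
      K * ENNReal.ofReal (levelQ q u (2 ^ k))) :
    ∫⁻ x, h x * ENNReal.ofReal (|u x| ^ r) ∂μ ≤ ∫⁻ x, h x ∂μ +
      ENNReal.ofReal (2 ^ r) * (K * ENNReal.ofReal S) := by
  refine (lintegral_mul_rpow_le_tsum hh hu hr).trans (add_le_add le_rfl ?_)
  refine ENNReal.tsum_le_of_sum_range_le fun n => ?_
  calc ∑ k ∈ Finset.range n,
        ENNReal.ofReal ((2 * 2 ^ k) ^ r) * ∫⁻ x in {x | 2 ^ k ≤ |u x|}, h x ∂μ
      ≤ ∑ k ∈ Finset.range n,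
        ENNReal.ofReal (2 ^ r) * (K * ENNReal.ofReal (levelQ q u (2 ^ k))) := by
        refine Finset.sum_le_sum fun k _ => ?_
        rw [Real.mul_rpow (by norm_num) (by positivity), ENNReal.ofReal_mul (by positivity),
          mul_assoc]
        exact mul_le_mul_right (hK k) _
    _ = ENNReal.ofReal (2 ^ r) *
        (K * ENNReal.ofReal (∑ k ∈ Finset.range n, levelQ q u (2 ^ k))) := by
        rw [ENNReal.ofReal_sum_of_nonneg fun k _ => levelQ_nonneg _ _ (by positivity),
          Finset.mul_sum, Finset.mul_sum]
    _ ≤ _ := by gcongr; exact hS n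

/-- Bounds the starting term of the dyadic sum. The superlevel set of a test function is contained
in `Ω`, so no norm of `φ` enters. -/
theorem levelQ_one_le {q : ℝ} (hqN : q ≤ N) (hΩ : volume (Ω : Set (EuclideanSpace ℝ (Fin N))) ≠ ∞)
    (hN : 0 < N) (φ : 𝓓(Ω, ℝ)) :
    levelQ q φ 1 ≤ (volume (Ω : Set (EuclideanSpace ℝ (Fin N)))).toReal ^ (1 - q / N) := by
  have hN0 : (0 : ℝ) < N := by exact_mod_cast hN
  unfold levelQ
  rw [Real.one_rpow, one_mul]
  refine Real.rpow_le_rpow ENNReal.toReal_nonneg (ENNReal.toReal_mono hΩ (measure_mono ?_)) ?_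
  · intro x hx
    refine φ.tsupport_subset (subset_tsupport _ fun h => ?_)
    simp only [mem_ofPred_eq, h, abs_zero] at hx
    linarith
  · rw [sub_nonneg, div_le_one hN0]
    exact hqN

/-- Uniform Lorentz-Sobolev bounds for test functions. -/
theorem exists_sum_levelQ_test_le (hN : 2 ≤ N) {p : Fin N → ℝ} (hp : ∀ i, 1 < p i)
    (hpN : harmonicMean p < N) (hΩ : volume (Ω : Set (EuclideanSpace ℝ (Fin N))) ≠ ∞) (M : ℝ) :
    ∃ S : ℝ, ∀ φ : 𝓓(Ω, ℝ), (∀ i, ∫ x, |partialDeriv i φ x| ^ p i ≤ M) →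
      ∀ n : ℕ, ∑ k ∈ Finset.range n, levelQ (harmonicMean p) φ (2 ^ k) ≤ S := by
  obtain ⟨K, hK, h⟩ := exists_sum_levelQ_le hN hp hpN
  refine ⟨2 * (volume (Ω : Set (EuclideanSpace ℝ (Fin N)))).toReal ^ (1 - harmonicMean p / N) +
    K * ∑ _i : Fin N, M, fun φ hφ n => ?_⟩
  refine (h φ (φ.contDiff.of_le (by simp)) φ.hasCompactSupport n).trans ?_
  gcongr with i
  · exact levelQ_one_le hpN.le hΩ (by omega) φ
  · exact hφ i

/-- Uniform bound with a weak Lebesgue weight. -/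
theorem exists_lintegral_weight_test_le (hN : 2 ≤ N) {p : Fin N → ℝ} (hp : ∀ i, 1 < p i)
    (hpN : harmonicMean p < N) (hΩ : volume (Ω : Set (EuclideanSpace ℝ (Fin N))) ≠ ∞)
    {b : EuclideanSpace ℝ (Fin N) → ℝ} {s : ℝ} (hs : 0 < s)
    (hb : MemWeakLp Ω b (N * s / harmonicMean p)) (M : ℝ) :
    ∃ K : ℝ≥0∞, K ≠ ∞ ∧ ∀ φ : 𝓓(Ω, ℝ), (∀ i, ∫ x, |partialDeriv i φ x| ^ p i ≤ M) →
      ∫⁻ x in Ω, ENNReal.ofReal (|b x| ^ s) * ENNReal.ofReal (|φ x| ^ harmonicMean p) ≤ K := by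
  have hq := harmonicMean_pos (by omega) hp
  have hN0 : (0 : ℝ) < N := by exact_mod_cast (by omega : 0 < N)
  obtain ⟨S, hS⟩ := exists_sum_levelQ_test_le hN hp hpN hΩ M
  obtain ⟨K, hK, hKb⟩ := hb.exists_setLIntegral_le hs (by
    rw [lt_div_iff₀ hq, mul_comm]
    exact mul_lt_mul_of_pos_right hpN hs)
  -- The Marcinkiewicz exponent `N s / p̄` is the one for which the integral of the weight over a
  -- superlevel set carries exactly the power of the measure that occurs in `levelQ`.
  have hexp : 1 - s / (N * s / harmonicMean p) = 1 - harmonicMean p / N := by field_simp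
  rw [hexp] at hKb
  have hfin := hb.lintegral_ne_top hs (by
    rw [lt_div_iff₀ hq, mul_comm]
    exact mul_lt_mul_of_pos_right hpN hs) hΩ
  refine ⟨_, ?_, fun φ hφ => lintegral_mul_rpow_le_of_levelQ
    (((continuous_abs.measurable.comp_aemeasurable hb.1).pow_const s).ennreal_ofReal)
    φ.continuous.measurable hq.le (hS φ hφ) (K := K) fun k => ?_⟩
  · finiteness
  · have h1 := hKb {x | 2 ^ k ≤ |φ x|}
      (volume_superlevel_lt_top φ.hasCompactSupport (by positivity)).ne
    unfold levelQ
    rw [ENNReal.ofReal_mul (by positivity), mul_left_comm]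
    exact mul_le_mul_right h1 _

theorem sobolevExp_pos (hN : 0 < N) {p : Fin N → ℝ} (hp : ∀ i, 1 < p i)
    (hpN : harmonicMean p < N) : 0 < sobolevExp p := by
  have hq := harmonicMean_pos hN hp
  have hN0 : (0 : ℝ) < N := by exact_mod_cast hN
  exact div_pos (mul_pos hN0 hq) (sub_pos.2 hpN)

/-- The anisotropic Sobolev inequality for test functions. -/
theorem exists_lintegral_sobolev_test_le (hN : 2 ≤ N) {p : Fin N → ℝ} (hp : ∀ i, 1 < p i)
    (hpN : harmonicMean p < N) (hΩ : volume (Ω : Set (EuclideanSpace ℝ (Fin N))) ≠ ∞) (M : ℝ) :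
    ∃ K : ℝ≥0∞, K ≠ ∞ ∧ ∀ φ : 𝓓(Ω, ℝ), (∀ i, ∫ x, |partialDeriv i φ x| ^ p i ≤ M) →
      ∫⁻ x in Ω, ENNReal.ofReal (|φ x| ^ sobolevExp p) ≤ K := by
  have hq := harmonicMean_pos (by omega) hp
  have hN0 : (0 : ℝ) < N := by exact_mod_cast (by omega : 0 < N)
  obtain ⟨S, hS⟩ := exists_sum_levelQ_test_le hN hp hpN hΩ M
  set q := harmonicMean p with hqdef
  set σ : ℝ := 1 - q / N with hσ
  have hσ0 : 0 < σ := by rw [hσ, sub_pos, div_lt_one hN0]; exact hpN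
  have hσ1 : σ ≤ 1 := by rw [hσ]; have : 0 < q / N := by positivity
                         linarith
  have hr : sobolevExp p = q / σ := by
    rw [sobolevExp, ← hqdef, hσ]
    have : (N : ℝ) - q ≠ 0 := (sub_pos.2 hpN).ne'
    have : 1 - q / N ≠ 0 := hσ0.ne'
    field_simp
  have hrpos := sobolevExp_pos (by omega) hp hpN
  refine ⟨(∫⁻ _ in (Ω : Set (EuclideanSpace ℝ (Fin N))), 1) + ENNReal.ofReal (2 ^ sobolevExp p) *
    (ENNReal.ofReal (S ^ (1 / σ - 1)) * ENNReal.ofReal S), ?_, fun φ hφ => ?_⟩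
  · rw [lintegral_const, Measure.restrict_apply_univ]
    finiteness
  have hX0 : ∀ k : ℕ, 0 ≤ levelQ q φ (2 ^ k) := fun k => levelQ_nonneg _ _ (by positivity)
  -- The inclusion of `ℓ¹` in `ℓ^{1/σ}`: each term is at most `S` and `1/σ ≥ 1`, so its power `1/σ`
  -- is at most `S^{1/σ - 1}` times the term. That power is `t^{p̄*} |{|φ| ≥ t}|`, the dyadic term
  -- of the `L^{p̄*}` norm.
  have hXS : ∀ k : ℕ, levelQ q φ (2 ^ k) ≤ S := fun k =>
    (Finset.single_le_sum (f := fun k => levelQ q φ (2 ^ k)) (fun j _ => hX0 j)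
      (Finset.self_mem_range_succ k)).trans (hS φ hφ (k + 1))
  have := lintegral_mul_rpow_le_of_levelQ (h := fun _ => 1)
    (μ := volume.restrict (Ω : Set (EuclideanSpace ℝ (Fin N)))) aemeasurable_const φ.continuous.measurable hrpos.le (hS φ hφ)
    (K := ENNReal.ofReal (S ^ (1 / σ - 1))) fun k => by
      set m := (volume {x | 2 ^ k ≤ |φ x|}).toReal with hm
      have hfin := (volume_superlevel_lt_top φ.hasCompactSupport
        (t := 2 ^ k) (by positivity)).ne
      have h2 : (0 : ℝ) < 2 ^ k := by positivity
      have hX : levelQ q φ (2 ^ k) = (2 ^ k) ^ q * m ^ σ := rfl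
      have h1 : ((2 : ℝ) ^ k) ^ sobolevExp p * m = levelQ q φ (2 ^ k) ^ (1 / σ) := by
        rw [hX, Real.mul_rpow (by positivity) (by positivity), ← Real.rpow_mul (by positivity),
          ← Real.rpow_mul ENNReal.toReal_nonneg, mul_one_div_cancel hσ0.ne', Real.rpow_one, hr,
          mul_one_div]
      have h3 : levelQ q φ (2 ^ k) ^ (1 / σ) ≤ S ^ (1 / σ - 1) * levelQ q φ (2 ^ k) := by
        have h4 : 0 ≤ 1 / σ - 1 := by
          rw [sub_nonneg, one_le_div hσ0]
          exact hσ1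
        have h5 : levelQ q φ (2 ^ k) ^ (1 / σ) =
            levelQ q φ (2 ^ k) ^ (1 / σ - 1) * levelQ q φ (2 ^ k) := by
          rcases (hX0 k).eq_or_lt with h0 | h0
          · rw [← h0, Real.zero_rpow (by positivity), mul_zero]
          · rw [← Real.rpow_add_one h0.ne', sub_add_cancel]
        rw [h5]
        exact mul_le_mul_of_nonneg_right (Real.rpow_le_rpow (hX0 k) (hXS k) h4) (hX0 k)
      calc ENNReal.ofReal ((2 ^ k) ^ sobolevExp p) *
            ∫⁻ x in {x | 2 ^ k ≤ |φ x|}, 1 ∂volume.restrict (Ω : Set _)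
          ≤ ENNReal.ofReal ((2 ^ k) ^ sobolevExp p) * ENNReal.ofReal m := by
            refine mul_le_mul_right ?_ _
            rw [setLIntegral_one, ENNReal.ofReal_toReal hfin]
            exact Measure.restrict_apply_le _ _
        _ = ENNReal.ofReal (levelQ q φ (2 ^ k) ^ (1 / σ)) := by
            rw [← ENNReal.ofReal_mul (by positivity), h1]
        _ ≤ ENNReal.ofReal (S ^ (1 / σ - 1) * levelQ q φ (2 ^ k)) := ENNReal.ofReal_le_ofReal h3
        _ = _ := ENNReal.ofReal_mul (Real.rpow_nonneg ((hX0 0).trans (hXS 0)) _)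
  simpa only [one_mul] using this

end

/-! ### Approximation by test functions and the chain rule in the Sobolev space -/

section

open Filter Topology

section General

variable {α : Type*} [MeasurableSpace α] {μ : Measure α}

/-- Fatou's lemma for a sequence of bounded integrals. -/
theorem lintegral_le_of_tendsto_ae {f : ℕ → α → ℝ≥0∞} {g : α → ℝ≥0∞} {K : ℝ≥0∞}
    (hf : ∀ n, AEMeasurable (f n) μ) (hK : ∀ n, ∫⁻ x, f n x ∂μ ≤ K)
    (hlim : ∀ᵐ x ∂μ, Tendsto (fun n => f n x) atTop (𝓝 (g x))) : ∫⁻ x, g x ∂μ ≤ K := by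
  calc ∫⁻ x, g x ∂μ = ∫⁻ x, liminf (fun n => f n x) atTop ∂μ :=
        lintegral_congr_ae (hlim.mono fun x hx => hx.liminf_eq.symm)
    _ ≤ liminf (fun n => ∫⁻ x, f n x ∂μ) atTop := lintegral_liminf_le' hf
    _ ≤ K := liminf_le_of_le (by isBoundedDefault) fun b hb => by
        obtain ⟨n, hn⟩ := hb.exists
        exact hn.trans (hK n)

/-- Convergence of the pairing of conjugate Lebesgue spaces. -/
theorem tendsto_integral_mul {q r : ℝ≥0∞} [ENNReal.HolderConjugate r q] {a : α → ℝ}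
    (ha : MemLp a r μ) {f : ℕ → α → ℝ} {g : α → ℝ} (hf : ∀ n, MemLp (f n) q μ) (hg : MemLp g q μ)
    (h : Tendsto (fun n => eLpNorm (f n - g) q μ) atTop (𝓝 0)) :
    Tendsto (fun n => ∫ x, a x * f n x ∂μ) atTop (𝓝 (∫ x, a x * g x ∂μ)) := by
  refine tendsto_integral_of_L1' _ (ha.1.mul hg.1) 
    (.of_forall fun n => ha.integrable_mul (hf n)) ?_
  have hb : ∀ n, eLpNorm ((fun x => a x * f n x) - fun x => a x * g x) 1 μ ≤
      eLpNorm a r μ * eLpNorm (f n - g) q μ := by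
    intro n
    have := eLpNorm_smul_le_mul_eLpNorm (p := r) (q := q) (r := 1) ((hf n).sub hg).1 ha.1
    refine le_trans (le_of_eq ?_) this
    congr 1
    ext x
    simp [mul_sub]
  refine tendsto_of_tendsto_of_tendsto_of_le_of_le tendsto_const_nhds ?_ (fun _ => zero_le) hb
  simpa using ENNReal.Tendsto.const_mul h (.inr ha.eLpNorm_ne_top)

/-- Dominated convergence in a Lebesgue space. -/
theorem tendsto_eLpNorm_of_dominated {q : ℝ} (hq : 0 < q) {f : ℕ → α → ℝ} {G : α → ℝ}
    (hf : ∀ n, AEStronglyMeasurable (f n) μ) (hG : MemLp G (ENNReal.ofReal q) μ)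
    (hle : ∀ n, ∀ᵐ x ∂μ, |f n x| ≤ G x)
    (hlim : ∀ᵐ x ∂μ, Tendsto (fun n => f n x) atTop (𝓝 0)) :
    Tendsto (fun n => eLpNorm (f n) (ENNReal.ofReal q) μ) atTop (𝓝 0) := by
  have hq0 : ENNReal.ofReal q ≠ 0 := by simpa using hq
  have hqr : (ENNReal.ofReal q).toReal = q := ENNReal.toReal_ofReal hq.le
  simp_rw [eLpNorm_eq_lintegral_rpow_enorm_toReal hq0 ENNReal.ofReal_ne_top, hqr]
  have h0 : Tendsto (fun n => ∫⁻ x, ‖f n x‖ₑ ^ q ∂μ) atTop (𝓝 (∫⁻ _, 0 ∂μ)) := by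
    refine tendsto_lintegral_of_dominated_convergence' (fun x => ‖G x‖ₑ ^ q)
      (fun n => (hf n).enorm.pow_const q) (fun n => ?_) ?_ ?_
    · filter_upwards [hle n] with x hx
      gcongr
      rw [enorm_le_iff_norm_le, Real.norm_eq_abs, Real.norm_eq_abs]
      exact hx.trans (le_abs_self _)
    · have := lintegral_rpow_enorm_lt_top_of_eLpNorm_lt_top hq0 ENNReal.ofReal_ne_top hG.2
      rw [hqr] at this
      exact this.ne
    · filter_upwards [hlim] with x hx
      have := ((ENNReal.continuous_rpow_const (y := q)).comp continuous_enorm).tendsto (0 : ℝ)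
      simpa [Function.comp_def, hq] using this.comp hx
  rw [lintegral_zero] at h0
  have := (ENNReal.continuous_rpow_const (y := 1 / q)).tendsto 0 |>.comp h0
  simpa [Function.comp_def, hq] using this

end General

variable {N : ℕ} {Ω : Opens (EuclideanSpace ℝ (Fin N))} {p : Fin N → ℝ} [hp : ∀ i, Fact (1 < p i)]

theorem W10.memLp_val (u : W10 Ω p) :
    MemLp (W10.val u) 1 (volume.restrict (Ω : Set (EuclideanSpace ℝ (Fin N)))) := Lp.memLp _

theorem W10.memLp_grad (u : W10 Ω p) (i : Fin N) : MemLp (fun x => W10.grad u x i)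
    (ENNReal.ofReal (p i)) (volume.restrict (Ω : Set (EuclideanSpace ℝ (Fin N)))) := Lp.memLp _

/-- Approximation of elements of `W₀^{1,p⃗}(Ω)` by test functions. -/
theorem W10.exists_test_seq (u : W10 Ω p) : ∃ φ : ℕ → 𝓓(Ω, ℝ),
    (∃ M : ℝ, ∀ n i, ∫ x, |partialDeriv i (φ n) x| ^ p i ≤ M) ∧
    Tendsto (fun n => eLpNorm (⇑(φ n) - W10.val u) 1
      (volume.restrict (Ω : Set (EuclideanSpace ℝ (Fin N))))) atTop (𝓝 0) ∧
    (∀ i, Tendsto (fun n => eLpNorm (partialDeriv i (φ n) - fun x => W10.grad u x i)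
      (ENNReal.ofReal (p i)) (volume.restrict (Ω : Set (EuclideanSpace ℝ (Fin N)))))
      atTop (𝓝 0)) ∧
    ∀ᵐ x ∂(volume.restrict (Ω : Set (EuclideanSpace ℝ (Fin N)))),
      Tendsto (fun n => φ n x) atTop (𝓝 (W10.val u x)) := by
  set μ := volume.restrict (Ω : Set (EuclideanSpace ℝ (Fin N))) with hμ
  have hu : (u : W1 Ω p) ∈ closure (LinearMap.range (ofTest Ω p) : Set (W1 Ω p)) := u.2
  obtain ⟨w, hw, hlim⟩ := mem_closure_iff_seq_limit.1 hu
  choose ψ hψ using hw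
  have hlim' : Tendsto (fun n => (ofTest Ω p (ψ n) : Ambient Ω p)) atTop (𝓝 (u : W1 Ω p)) := by
    simp_rw [hψ]
    exact (continuous_subtype_val.tendsto _).comp hlim
  have h1 := (continuous_fst.tendsto _).comp hlim'
  have h2 : ∀ i, Tendsto (fun n => (ofTest Ω p (ψ n) : Ambient Ω p).2 i) atTop
      (𝓝 (((u : W1 Ω p) : Ambient Ω p).2 i)) := fun i =>
    (((continuous_apply i).comp continuous_snd).tendsto _).comp hlim'
  have hae1 : ∀ n, ((ofTest Ω p (ψ n) : Ambient Ω p).1 : EuclideanSpace ℝ (Fin N) → ℝ)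
      =ᵐ[μ] ψ n := fun n => (memLp_test Ω (ψ n) 1).coeFn_toLp
  have hae2 : ∀ i n, ((ofTest Ω p (ψ n) : Ambient Ω p).2 i : EuclideanSpace ℝ (Fin N) → ℝ)
      =ᵐ[μ] partialDeriv i (ψ n) := fun i n =>
    (memLp_partialDeriv Ω i (ψ n) (ENNReal.ofReal (p i))).coeFn_toLp
  -- Norm convergence survives the passage to an a.e. convergent subsequence. The pointwise limit is
  -- what Fatou's lemma and dominated convergence use later.
  obtain ⟨ns, hns, hnsae⟩ := (tendstoInMeasure_of_tendsto_Lp h1).exists_seq_tendsto_ae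
  refine ⟨fun n => ψ (ns n), ?_, ?_, fun i => ?_, ?_⟩
  · have hb : ∀ i, ∃ M : ℝ, 0 ≤ M ∧ ∀ n, ∫ x, |partialDeriv i (ψ n) x| ^ p i ≤ M := by
      intro i
      have hp0 : 0 < p i := zero_lt_one.trans (hp i).out
      obtain ⟨M, hM⟩ := (h2 i).norm.bddAbove_range
      refine ⟨M ^ p i, Real.rpow_nonneg ((norm_nonneg _).trans (hM ⟨0, rfl⟩)) _, fun n => ?_⟩
      have hMn : ‖(ofTest Ω p (ψ n) : Ambient Ω p).2 i‖ ≤ M := hM ⟨n, rfl⟩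
      have e : ∫ x, |partialDeriv i (ψ n) x| ^ p i = ∫ x, |partialDeriv i (ψ n) x| ^ p i ∂μ := by
        refine (setIntegral_eq_integral_of_forall_compl_eq_zero fun x hx => ?_).symm
        have : partialDeriv i (ψ n) x = 0 := by
          refine image_eq_zero_of_notMem_tsupport fun h => hx ((ψ n).tsupport_subset ?_)
          exact tsupport_fderiv_apply_subset ℝ (EuclideanSpace.single i 1) h
        rw [this, abs_zero, Real.zero_rpow hp0.ne']
      have hm := memLp_partialDeriv Ω i (ψ n) (ENNReal.ofReal (p i))
      have hI : 0 ≤ ∫ x, |partialDeriv i (ψ n) x| ^ p i ∂μ := integral_nonneg fun x => by positivity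
      have e2 : ‖(ofTest Ω p (ψ n) : Ambient Ω p).2 i‖ =
          (∫ x, |partialDeriv i (ψ n) x| ^ p i ∂μ) ^ (p i)⁻¹ := by
        change ‖hm.toLp _‖ = _
        rw [Lp.norm_toLp, hm.eLpNorm_eq_integral_rpow_norm (by simpa using hp0)
          ENNReal.ofReal_ne_top, ENNReal.toReal_ofReal (by positivity),
          ENNReal.toReal_ofReal hp0.le]
        rfl
      rw [e]
      rw [e2] at hMn
      have := Real.rpow_le_rpow (by positivity) hMn hp0.le
      rwa [← Real.rpow_mul hI, inv_mul_cancel₀ hp0.ne', Real.rpow_one] at this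
    choose M hM0 hM using hb
    exact ⟨∑ i, M i, fun n i => (hM i (ns n)).trans
      (Finset.single_le_sum (fun j _ => hM0 j) (Finset.mem_univ i))⟩
  · have := ((Lp.tendsto_Lp_iff_tendsto_eLpNorm' _ _).1 h1).comp hns.tendsto_atTop
    refine this.congr fun n => eLpNorm_congr_ae ?_
    exact (hae1 (ns n)).sub EventuallyEq.rfl
  · have := ((Lp.tendsto_Lp_iff_tendsto_eLpNorm' _ _).1 (h2 i)).comp hns.tendsto_atTop
    refine this.congr fun n => eLpNorm_congr_ae ?_
    exact (hae2 i (ns n)).sub EventuallyEq.rfl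
  · filter_upwards [hnsae, ae_all_iff.2 fun n => hae1 (ns n)] with x hx hx'
    exact hx.congr hx'

/-- Limits of test functions belong to `W₀^{1,p⃗}(Ω)`. -/
theorem W10.exists_of_tendsto {ψ : ℕ → 𝓓(Ω, ℝ)} {f : EuclideanSpace ℝ (Fin N) → ℝ}
    {g : Fin N → EuclideanSpace ℝ (Fin N) → ℝ}
    (hf : MemLp f 1 (volume.restrict (Ω : Set (EuclideanSpace ℝ (Fin N)))))
    (hg : ∀ i, MemLp (g i) (ENNReal.ofReal (p i))
      (volume.restrict (Ω : Set (EuclideanSpace ℝ (Fin N)))))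
    (h1 : Tendsto (fun n => eLpNorm (⇑(ψ n) - f) 1
      (volume.restrict (Ω : Set (EuclideanSpace ℝ (Fin N))))) atTop (𝓝 0))
    (h2 : ∀ i, Tendsto (fun n => eLpNorm (partialDeriv i (ψ n) - g i)
      (ENNReal.ofReal (p i)) (volume.restrict (Ω : Set (EuclideanSpace ℝ (Fin N)))))
      atTop (𝓝 0)) :
    ∃ w : W10 Ω p, W10.val w =ᵐ[volume.restrict (Ω : Set (EuclideanSpace ℝ (Fin N)))] f ∧
      Tendsto (fun n => testW10 Ω p (ψ n)) atTop (𝓝 w) := by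
  set μ := volume.restrict (Ω : Set (EuclideanSpace ℝ (Fin N))) with hμ
  -- The integration by parts identity of each `ψ n` passes to the limit, as both sides are pairings
  -- with a fixed function in the conjugate Lebesgue space.
  have hweak : ∀ i, IsWeakPartial Ω i f (g i) := by
    intro i φ
    have : Fact (1 ≤ ENNReal.ofReal (p i)) := inferInstance
    have : (ENNReal.ofReal (p i)).HolderConjugate (ENNReal.conjExponent (ENNReal.ofReal (p i))) :=
      .conjExponent this.out
    have : (ENNReal.conjExponent (ENNReal.ofReal (p i))).HolderConjugate (ENNReal.ofReal (p i)) :=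
      .symm
    have a1 := tendsto_integral_mul (r := ∞) (memLp_partialDeriv Ω i φ ∞)
      (fun n => memLp_test Ω (ψ n) 1) hf h1
    have a2 := tendsto_integral_mul
      (memLp_test Ω φ (ENNReal.conjExponent (ENNReal.ofReal (p i)))) (fun n => memLp_partialDeriv Ω i (ψ n) _)
      (hg i) (h2 i)
    have a3 : ∀ n, ∫ x, partialDeriv i φ x * ψ n x ∂μ = -∫ x, φ x * partialDeriv i (ψ n) x ∂μ := by
      intro n
      have := isWeakPartial_test Ω i (ψ n) φ
      simpa only [mul_comm] using this
    have := tendsto_nhds_unique (a1.congr a3) a2.neg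
    simpa only [mul_comm] using this
  set z : Ambient Ω p := (hf.toLp f, fun i => (hg i).toLp (g i)) with hz
  have hz1 : z ∈ W1 Ω p := by
    intro i φ
    have b1 := hf.coeFn_toLp
    have b2 := (hg i).coeFn_toLp
    refine Eq.trans (integral_congr_ae ?_)
      ((hweak i φ).trans (congrArg Neg.neg (integral_congr_ae ?_)))
    · filter_upwards [b1] with x hx
      rw [hx]
    · filter_upwards [b2] with x hx
      rw [hx]
  have hlim : Tendsto (fun n => ofTest Ω p (ψ n)) atTop (𝓝 (⟨z, hz1⟩ : W1 Ω p)) := by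
    rw [tendsto_subtype_rng]
    refine Tendsto.prodMk_nhds ?_ (tendsto_pi_nhds.2 fun i => ?_)
    · exact (Lp.tendsto_Lp_iff_tendsto_eLpNorm'' _ _ _ _).2 h1
    · exact (Lp.tendsto_Lp_iff_tendsto_eLpNorm'' _ _ _ _).2 (h2 i)
  have hz2 : (⟨z, hz1⟩ : W1 Ω p) ∈ W10 Ω p :=
    mem_closure_of_tendsto hlim (.of_forall fun n => ⟨ψ n, rfl⟩)
  refine ⟨⟨_, hz2⟩, hf.coeFn_toLp, ?_⟩
  rw [tendsto_subtype_rng]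
  exact hlim

/-- Composition of a test function with a smooth function vanishing at `0`. -/
def compTest {H : ℝ → ℝ} (hH : ContDiff ℝ ((⊤ : ℕ∞) : WithTop ℕ∞) H) (h0 : H 0 = 0)
    (φ : 𝓓(Ω, ℝ)) : 𝓓(Ω, ℝ) where
  toFun x := H (φ x)
  contDiff' := hH.comp φ.contDiff
  hasCompactSupport' := φ.hasCompactSupport.comp_left h0
  tsupport_subset' := (tsupport_comp_subset h0 φ).trans φ.tsupport_subset

theorem partialDeriv_compTest {H : ℝ → ℝ} (hH : ContDiff ℝ ((⊤ : ℕ∞) : WithTop ℕ∞) H)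
    (h0 : H 0 = 0) (φ : 𝓓(Ω, ℝ)) (i : Fin N) (x : EuclideanSpace ℝ (Fin N)) :
    partialDeriv i (compTest hH h0 φ) x = deriv H (φ x) * partialDeriv i φ x :=
  partialDeriv_comp (φ.contDiff.differentiable (by simp)) (hH.differentiable (by simp)) i x

/-- Convergence of compositions with a smooth function with bounded derivative. -/
theorem tendsto_compTest {H : ℝ → ℝ} (hH : ContDiff ℝ ((⊤ : ℕ∞) : WithTop ℕ∞) H) (h0 : H 0 = 0)
    {C : ℝ} (hC : ∀ s, |deriv H s| ≤ C) {φ : ℕ → 𝓓(Ω, ℝ)} {u : W10 Ω p}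
    (h1 : Tendsto (fun n => eLpNorm (⇑(φ n) - W10.val u) 1
      (volume.restrict (Ω : Set (EuclideanSpace ℝ (Fin N))))) atTop (𝓝 0))
    (h2 : ∀ i, Tendsto (fun n => eLpNorm (partialDeriv i (φ n) - fun x => W10.grad u x i)
      (ENNReal.ofReal (p i)) (volume.restrict (Ω : Set (EuclideanSpace ℝ (Fin N)))))
      atTop (𝓝 0))
    (h3 : ∀ᵐ x ∂(volume.restrict (Ω : Set (EuclideanSpace ℝ (Fin N)))),
      Tendsto (fun n => φ n x) atTop (𝓝 (W10.val u x))) :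
    Tendsto (fun n => eLpNorm (⇑(compTest hH h0 (φ n)) - fun x => H (W10.val u x)) 1
      (volume.restrict (Ω : Set (EuclideanSpace ℝ (Fin N))))) atTop (𝓝 0) ∧
    (∀ i, MemLp (fun x => deriv H (W10.val u x) * W10.grad u x i) (ENNReal.ofReal (p i))
      (volume.restrict (Ω : Set (EuclideanSpace ℝ (Fin N))))) ∧
    ∀ i, Tendsto (fun n => eLpNorm (partialDeriv i (compTest hH h0 (φ n)) -
        fun x => deriv H (W10.val u x) * W10.grad u x i)
      (ENNReal.ofReal (p i)) (volume.restrict (Ω : Set (EuclideanSpace ℝ (Fin N)))))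
      atTop (𝓝 0) := by
  set μ := volume.restrict (Ω : Set (EuclideanSpace ℝ (Fin N))) with hμ
  have hC0 : 0 ≤ C := (abs_nonneg _).trans (hC 0)
  have hLip : ∀ s t, |H s - H t| ≤ C * |s - t| := fun s t =>
    Convex.norm_image_sub_le_of_norm_deriv_le (s := univ)
      (fun x _ => (hH.differentiable (by simp)) x) (fun x _ => hC x) convex_univ
      (mem_univ t) (mem_univ s)
  have hdc : Continuous (deriv H) := hH.continuous_deriv (by simp)
  have hum : AEStronglyMeasurable (fun x => deriv H (W10.val u x)) μ :=
    hdc.comp_aestronglyMeasurable (W10.memLp_val u).1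
  have hmem : ∀ i, MemLp (fun x => deriv H (W10.val u x) * W10.grad u x i) (ENNReal.ofReal (p i)) μ := by
    intro i
    refine ((W10.memLp_grad u i).const_mul C).mono (hum.mul (W10.memLp_grad u i).1) (.of_forall fun x => ?_)
    rw [norm_mul, norm_mul, Real.norm_of_nonneg hC0]
    gcongr
    exact hC _
  refine ⟨?_, hmem, fun i => ?_⟩
  · have hb : ∀ n, eLpNorm (⇑(compTest hH h0 (φ n)) - fun x => H (W10.val u x)) 1 μ ≤
        ENNReal.ofReal C * eLpNorm (⇑(φ n) - W10.val u) 1 μ := fun n =>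
      eLpNorm_le_mul_eLpNorm_of_ae_le_mul (.of_forall fun x => hLip _ _) 1
    refine tendsto_of_tendsto_of_tendsto_of_le_of_le tendsto_const_nhds ?_ (fun _ => zero_le) hb
    simpa using ENNReal.Tendsto.const_mul h1 (.inr ENNReal.ofReal_ne_top)
  · have hp1 : 1 < p i := (hp i).out
    have hA : ∀ n, AEStronglyMeasurable
        (fun x => deriv H (φ n x) * (partialDeriv i (φ n) x - W10.grad u x i)) μ := fun n =>
      ((hdc.comp (φ n).continuous).aestronglyMeasurable).mul
        ((memLp_partialDeriv Ω i (φ n) (ENNReal.ofReal (p i))).sub (W10.memLp_grad u i)).1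
    have hB : ∀ n, AEStronglyMeasurable
        (fun x => (deriv H (φ n x) - deriv H (W10.val u x)) * W10.grad u x i) μ := fun n =>
      (((hdc.comp (φ n).continuous).aestronglyMeasurable).sub hum).mul (W10.memLp_grad u i).1
    have hb : ∀ n, eLpNorm (partialDeriv i (compTest hH h0 (φ n)) -
        fun x => deriv H (W10.val u x) * W10.grad u x i) (ENNReal.ofReal (p i)) μ ≤
        ENNReal.ofReal C * eLpNorm (partialDeriv i (φ n) - fun x => W10.grad u x i)
          (ENNReal.ofReal (p i)) μ +
        eLpNorm (fun x => (deriv H (φ n x) - deriv H (W10.val u x)) * W10.grad u x i)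
          (ENNReal.ofReal (p i)) μ := by
      intro n
      -- The first summand is controlled by the bound on `H'` and the convergence of gradients. In
      -- the second the gradient is fixed, so a.e. convergence and the majorant `2C |∂ᵢu|` suffice.
      have e : (partialDeriv i (compTest hH h0 (φ n)) -
          fun x => deriv H (W10.val u x) * W10.grad u x i) =
          (fun x => deriv H (φ n x) * (partialDeriv i (φ n) x - W10.grad u x i)) +
          fun x => (deriv H (φ n x) - deriv H (W10.val u x)) * W10.grad u x i := by
        ext x
        simp only [Pi.sub_apply, Pi.add_apply, partialDeriv_compTest]
        ring
      rw [e]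
      refine (eLpNorm_add_le (hA n) (hB n) Fact.out).trans ?_
      gcongr
      refine eLpNorm_le_mul_eLpNorm_of_ae_le_mul (.of_forall fun x => ?_) _
      rw [norm_mul]
      gcongr
      · exact hC _
      · rfl
    refine tendsto_of_tendsto_of_tendsto_of_le_of_le tendsto_const_nhds ?_ (fun _ => zero_le) hb
    have t1 := ENNReal.Tendsto.const_mul (a := ENNReal.ofReal C) (h2 i) (.inr ENNReal.ofReal_ne_top)
    have t2 : Tendsto (fun n => eLpNorm (fun x => (deriv H (φ n x) - deriv H (W10.val u x)) *
        W10.grad u x i) (ENNReal.ofReal (p i)) μ) atTop (𝓝 0) := by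
      refine tendsto_eLpNorm_of_dominated (zero_lt_one.trans hp1) hB
        ((W10.memLp_grad u i).norm.const_mul (2 * C)) (fun n => .of_forall fun x => ?_) ?_
      · rw [abs_mul, Real.norm_eq_abs]
        gcongr
        have := abs_sub (deriv H (φ n x)) (deriv H (W10.val u x))
        linarith [hC (φ n x), hC (W10.val u x)]
      · filter_upwards [h3] with x hx
        have := (((hdc.tendsto _).comp hx).sub_const (deriv H (W10.val u x))).mul_const (W10.grad u x i)
        simpa using this
    simpa using t1.add t2

end

/-! ### Carathéodory superposition, directional Poincaré inequality and embeddings -/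

section

open Filter Topology

variable {N : ℕ} {Ω : Opens (EuclideanSpace ℝ (Fin N))}

/-- The superposition operator of a Carathéodory function preserves measurability. -/
theorem IsCaratheodory.aestronglyMeasurable_comp {S : Type*} [TopologicalSpace S]
    {f : EuclideanSpace ℝ (Fin N) → S → ℝ} (hf : IsCaratheodory Ω f)
    {v : EuclideanSpace ℝ (Fin N) → S}
    (hv : AEStronglyMeasurable v (volume.restrict (Ω : Set (EuclideanSpace ℝ (Fin N))))) :
    AEStronglyMeasurable (fun x => f x (v x))
      (volume.restrict (Ω : Set (EuclideanSpace ℝ (Fin N)))) := by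
  set μ := volume.restrict (Ω : Set (EuclideanSpace ℝ (Fin N))) with hμ
  -- For simple functions the superposition is a finite sum of restrictions of `f · y`; continuity
  -- in the second variable carries measurability to the limit.
  have hs : ∀ s : SimpleFunc (EuclideanSpace ℝ (Fin N)) S, AEMeasurable (fun x => f x (s x)) μ := by
    classical
    intro s
    have e : (fun x => f x (s x)) =
        fun x => ∑ y ∈ s.range, (s ⁻¹' {y}).indicator (fun x => f x y) x := by
      ext x
      rw [Finset.sum_eq_single (s x)]
      · simp
      · intro y _ hy
        exact indicator_of_notMem (fun h => hy (by simpa using h.symm)) _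
      · intro h
        exact absurd (s.mem_range_self x) h
    rw [e]
    exact Finset.aemeasurable_fun_sum _ fun y _ => (hf.1 y).indicator (s.measurableSet_fiber y)
  obtain ⟨v', hv', hvv'⟩ := hv
  refine (aemeasurable_of_tendsto_metrizable_ae atTop (fun n => hs (hv'.approx n))
    (g := fun x => f x (v x)) ?_).aestronglyMeasurable
  filter_upwards [hvv', hf.2] with x hx hc
  rw [hx]
  exact (hc.tendsto _).comp (hv'.tendsto_approx x)

/-- Young's inequality in the form `a^{q-1} t ≤ κ a^q + κ^{1-q} t^q`. -/
theorem rpow_sub_one_mul_le {q κ a t : ℝ} (hq : 1 < q) (hκ : 0 < κ) (ha : 0 ≤ a) (ht : 0 ≤ t) :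
    a ^ (q - 1) * t ≤ κ * a ^ q + κ ^ (1 - q) * t ^ q := by
  have h1 : ∀ s : ℝ, 0 ≤ s → s ^ (q - 1) * s = s ^ q := fun s hs => by
    rcases hs.eq_or_lt with h | h
    · rw [← h, mul_zero, Real.zero_rpow (by linarith)]
    · rw [← Real.rpow_add_one h.ne', sub_add_cancel]
  rcases le_or_gt t (κ * a) with h | h
  · have : a ^ (q - 1) * t ≤ a ^ (q - 1) * (κ * a) := by gcongr
    have h2 := h1 a ha
    have : 0 ≤ κ ^ (1 - q) * t ^ q := by positivity
    nlinarith
  · have h2 : a ^ (q - 1) ≤ κ ^ (1 - q) * t ^ (q - 1) := by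
      have h3 : a ≤ t / κ := by rw [le_div_iff₀ hκ]; linarith
      have h4 := Real.rpow_le_rpow ha h3 (by linarith : 0 ≤ q - 1)
      rw [Real.div_rpow ht hκ.le, div_eq_mul_inv, ← Real.rpow_neg hκ.le, neg_sub, mul_comm] at h4
      exact h4
    have h3 := mul_le_mul_of_nonneg_right h2 ht
    rw [mul_assoc, h1 t ht] at h3
    have : 0 ≤ κ * a ^ q := by positivity
    linarith

/-- Integration by parts against a coordinate function. -/
theorem integral_eq_neg_integral_coord_mul {g : EuclideanSpace ℝ (Fin N) → ℝ}
    (hg : ContDiff ℝ 1 g) (h2g : HasCompactSupport g) (i : Fin N) :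
    ∫ x, g x = -∫ x, x i * partialDeriv i g x := by
  set ℓ : EuclideanSpace ℝ (Fin N) → ℝ := fun x => x i with hℓ
  have hℓd : ∀ x, HasFDerivAt ℓ (EuclideanSpace.proj i : EuclideanSpace ℝ (Fin N) →L[ℝ] ℝ) x :=
    fun x => (EuclideanSpace.proj i : EuclideanSpace ℝ (Fin N) →L[ℝ] ℝ).hasFDerivAt
  have hℓ1 : ∀ x, fderiv ℝ ℓ x (EuclideanSpace.single i 1) = 1 := by
    intro x
    rw [(hℓd x).fderiv]
    simp
  have hℓc : Continuous ℓ := (EuclideanSpace.proj i : EuclideanSpace ℝ (Fin N) →L[ℝ] ℝ).continuous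
  have hc := continuous_partialDeriv_of_contDiff hg i
  have h := integral_mul_fderiv_eq_neg_fderiv_mul_of_integrable
    (μ := (volume : Measure (EuclideanSpace ℝ (Fin N)))) (f := ℓ) (g := g)
    (v := EuclideanSpace.single i 1) ?_ ?_ ?_ (fun x _ => (hℓd x).differentiableAt)
    (fun x _ => hg.differentiable one_ne_zero x)
  · simp only [hℓ1, one_mul] at h
    rw [eq_neg_iff_add_eq_zero, add_comm, ← eq_neg_iff_add_eq_zero]
    exact h
  · simpa only [hℓ1, one_mul] using hg.continuous.integrable_of_hasCompactSupport h2g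
  · exact (hℓc.mul hc).integrable_of_hasCompactSupport
      (h2g.fderiv_apply ℝ (EuclideanSpace.single i 1)).mul_left
  · exact (hℓc.mul hg.continuous).integrable_of_hasCompactSupport h2g.mul_left

/-- The Poincaré inequality in a single direction, for test functions. -/
theorem integral_rpow_test_le {q R : ℝ} (hq : 1 < q) (hR : 0 < R) (i : Fin N)
    (hΩR : ∀ x ∈ Ω, |x i| ≤ R) (φ : 𝓓(Ω, ℝ)) :
    ∫ x, |φ x| ^ q ≤ 2 * (R * q * (1 / (2 * R * q)) ^ (1 - q)) *
      ∫ x, |partialDeriv i φ x| ^ q := by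
  have hq0 : 0 < q := by linarith
  have hφ1 : ContDiff ℝ 1 φ := φ.contDiff.of_le (by simp)
  set H : ℝ → ℝ := fun s => |s| ^ q with hH
  have hHd : ∀ s, HasDerivAt H (q * |s| ^ (q - 2) * s) s := fun s => hasDerivAt_abs_rpow s hq
  have hH1 : ContDiff ℝ 1 H := by simpa using contDiff_norm_rpow (E := ℝ) hq
  have hHle : ∀ s, |deriv H s| ≤ q * |s| ^ (q - 1) := by
    intro s
    rw [(hHd s).deriv, abs_mul, abs_of_nonneg (by positivity), mul_assoc]
    refine mul_le_mul_of_nonneg_left ?_ hq0.le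
    rcases eq_or_ne s 0 with h | h
    · rw [h, abs_zero, mul_zero]
      positivity
    · rw [← Real.rpow_add_one (abs_pos.2 h).ne']
      exact le_of_eq (by congr 1; ring)
  have hg2 : HasCompactSupport fun x => H (φ x) :=
    φ.hasCompactSupport.comp_left (g := H) (by simp [hH, hq0.ne'])
  have hI := integral_eq_neg_integral_coord_mul (hH1.comp hφ1) hg2 i
  -- Gives `R q κ = 1/2`, so that half of `∫ |φ|^q` is absorbed on the left.
  set κ : ℝ := 1 / (2 * R * q) with hκ
  have hκ0 : 0 < κ := by positivity
  have i1 : Integrable fun x => |φ x| ^ q :=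
    (hH1.comp hφ1).continuous.integrable_of_hasCompactSupport hg2
  have i2 := integrable_partialDeriv_rpow hφ1 φ.hasCompactSupport i hq0
  have hpt : ∀ x, -(x i * partialDeriv i (H ∘ φ) x) ≤
      1 / 2 * |φ x| ^ q + R * q * κ ^ (1 - q) * |partialDeriv i φ x| ^ q := by
    intro x
    rw [show partialDeriv i (H ∘ φ) x = _ from partialDeriv_comp
      (hφ1.differentiable one_ne_zero) (hH1.differentiable one_ne_zero) i x]
    by_cases hx : x ∈ Ω
    · refine (neg_le_abs _).trans ?_
      rw [abs_mul, abs_mul]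
      have h1 := rpow_sub_one_mul_le hq hκ0 (abs_nonneg (φ x)) (abs_nonneg (partialDeriv i φ x))
      calc |x i| * (|deriv H (φ x)| * |partialDeriv i φ x|)
          ≤ R * (q * |φ x| ^ (q - 1) * |partialDeriv i φ x|) := by
            gcongr
            · exact hΩR x hx
            · exact hHle _
        _ = R * q * (|φ x| ^ (q - 1) * |partialDeriv i φ x|) := by ring
        _ ≤ R * q * (κ * |φ x| ^ q + κ ^ (1 - q) * |partialDeriv i φ x| ^ q) := by gcongr
        _ = _ := by
          have : R * q * κ = 1 / 2 := by rw [hκ]; field_simp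
          rw [← this]
          ring
    · have : φ x = 0 := image_eq_zero_of_notMem_tsupport fun h => hx (φ.tsupport_subset h)
      rw [this, (hHd 0).deriv, mul_zero, zero_mul, mul_zero, neg_zero]
      positivity
  have h2 : ∫ x, |φ x| ^ q ≤ ∫ x, (1 / 2 * |φ x| ^ q +
      R * q * κ ^ (1 - q) * |partialDeriv i φ x| ^ q) := by
    rw [← integral_neg] at hI
    refine (le_of_eq hI).trans (integral_mono ?_ ((i1.const_mul _).add (i2.const_mul _)) hpt)
    refine Integrable.neg ?_
    refine Continuous.integrable_of_hasCompactSupport ?_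
      (hg2.fderiv_apply ℝ (EuclideanSpace.single i 1)).mul_left
    exact (EuclideanSpace.proj i : EuclideanSpace ℝ (Fin N) →L[ℝ] ℝ).continuous.mul
      (continuous_partialDeriv_of_contDiff (hH1.comp hφ1) i)
  rw [integral_add (i1.const_mul _) (i2.const_mul _), integral_const_mul, integral_const_mul] at h2
  linarith

theorem exists_coord_bound (hΩ : Bornology.IsBounded (Ω : Set (EuclideanSpace ℝ (Fin N)))) :
    ∃ R : ℝ, 0 < R ∧ ∀ x ∈ Ω, ∀ i, |x i| ≤ R := by
  obtain ⟨R, hR, hΩR⟩ := hΩ.exists_pos_norm_le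
  exact ⟨R, hR, fun x hx i => (PiLp.norm_apply_le x i).trans (hΩR x hx)⟩

section Embeddings

variable {p : Fin N → ℝ} [hp : ∀ i, Fact (1 < p i)]

theorem tendsto_ofReal_abs_rpow {f : ℕ → ℝ} {a q : ℝ} (hq : 0 ≤ q)
    (h : Tendsto f atTop (𝓝 a)) :
    Tendsto (fun n => ENNReal.ofReal (|f n| ^ q)) atTop (𝓝 (ENNReal.ofReal (|a| ^ q))) :=
  (ENNReal.continuous_ofReal.tendsto _).comp
    (((continuous_abs.tendsto a).comp h).rpow_const (.inr hq))

/-- The anisotropic Sobolev inequality. -/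
theorem W10.lintegral_sobolev_ne_top (hN : 2 ≤ N) (hpN : harmonicMean p < N)
    (hΩ : volume (Ω : Set (EuclideanSpace ℝ (Fin N))) ≠ ∞) (u : W10 Ω p) :
    ∫⁻ x in Ω, ENNReal.ofReal (|W10.val u x| ^ sobolevExp p) ≠ ∞ := by
  obtain ⟨φ, ⟨M, hM⟩, -, -, hae⟩ := W10.exists_test_seq u
  obtain ⟨K, hK, h⟩ := exists_lintegral_sobolev_test_le hN (fun i => (hp i).out) hpN hΩ M
  have hpos := sobolevExp_pos (by omega) (fun i => (hp i).out) hpN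
  refine ((lintegral_le_of_tendsto_ae (fun n => ?_) (fun n => h (φ n) (hM n)) ?_).trans_lt
    hK.lt_top).ne
  · have := (φ n).continuous
    exact ((this.abs.rpow_const fun _ => .inr hpos.le).measurable.ennreal_ofReal).aemeasurable
  · filter_upwards [hae] with x hx using tendsto_ofReal_abs_rpow hpos.le hx

/-- The weighted inequality with weights in a Marcinkiewicz space. -/
theorem W10.lintegral_weight_ne_top (hN : 2 ≤ N) (hpN : harmonicMean p < N)
    (hΩ : volume (Ω : Set (EuclideanSpace ℝ (Fin N))) ≠ ∞)
    {b : EuclideanSpace ℝ (Fin N) → ℝ} {s : ℝ} (hs : 0 < s)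
    (hb : MemWeakLp Ω b (N * s / harmonicMean p)) (u : W10 Ω p) :
    ∫⁻ x in Ω, ENNReal.ofReal (|b x| ^ s) * ENNReal.ofReal (|W10.val u x| ^ harmonicMean p)
      ≠ ∞ := by
  obtain ⟨φ, ⟨M, hM⟩, -, -, hae⟩ := W10.exists_test_seq u
  obtain ⟨K, hK, h⟩ := exists_lintegral_weight_test_le hN (fun i => (hp i).out) hpN hΩ hs hb M
  have hpos := harmonicMean_pos (by omega) (fun i => (hp i).out)
  refine ((lintegral_le_of_tendsto_ae (fun n => ?_) (fun n => h (φ n) (hM n)) ?_).trans_lt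
    hK.lt_top).ne
  · have := (φ n).continuous
    exact ((continuous_abs.measurable.comp_aemeasurable hb.1).pow_const s).ennreal_ofReal.mul
      ((this.abs.rpow_const fun _ => .inr hpos.le).measurable.ennreal_ofReal).aemeasurable
  · filter_upwards [hae] with x hx
    exact ENNReal.Tendsto.const_mul (tendsto_ofReal_abs_rpow hpos.le hx)
      (.inr ENNReal.ofReal_ne_top)

/-- Elements of `W₀^{1,p⃗}(Ω)` are in `L^{pᵢ}(Ω)` for every `i`. -/
theorem W10.lintegral_rpow_ne_top
    (hΩ : Bornology.IsBounded (Ω : Set (EuclideanSpace ℝ (Fin N)))) (u : W10 Ω p) (i : Fin N) :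
    ∫⁻ x in Ω, ENNReal.ofReal (|W10.val u x| ^ p i) ≠ ∞ := by
  obtain ⟨φ, ⟨M, hM⟩, -, -, hae⟩ := W10.exists_test_seq u
  obtain ⟨R, hR, hΩR⟩ := exists_coord_bound hΩ
  have hp1 : 1 < p i := (hp i).out
  refine ((lintegral_le_of_tendsto_ae
    (f := fun n x => ENNReal.ofReal (|φ n x| ^ p i)) (K := ENNReal.ofReal (2 * (R * p i * (1 / (2 * R * p i)) ^ (1 - p i)) * M))
    (fun n => ?_) (fun n => ?_) ?_).trans_lt ENNReal.ofReal_lt_top).ne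
  · have := (φ n).continuous
    exact ((this.abs.rpow_const fun _ => .inr (by linarith)).measurable.ennreal_ofReal).aemeasurable
  · refine (setLIntegral_le_lintegral _ _).trans ?_
    rw [← ofReal_integral_eq_lintegral_ofReal _ (.of_forall fun x => by positivity)]
    · refine ENNReal.ofReal_le_ofReal ((integral_rpow_test_le hp1 hR i
        (fun x hx => hΩR x hx i) (φ n)).trans ?_)
      gcongr
      exact hM n i
    · refine Continuous.integrable_of_hasCompactSupport
        ((φ n).continuous.abs.rpow_const fun _ => .inr (by linarith)) ?_
      exact (φ n).hasCompactSupport.comp_left (g := fun s => |s| ^ p i)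
        (by simp [(by linarith : p i ≠ 0)])
  · filter_upwards [hae] with x hx using tendsto_ofReal_abs_rpow (by linarith) hx

/-- If some `pᵢ` exceeds `p̄*`, the Sobolev embedding does not reach it, but the Poincaré inequality
in the direction of the largest exponent does. -/
theorem W10.lintegral_pInfty_ne_top (hN : 2 ≤ N) (hpN : harmonicMean p < N)
    (hΩ : Bornology.IsBounded (Ω : Set (EuclideanSpace ℝ (Fin N)))) (u : W10 Ω p) :
    ∫⁻ x in Ω, ENNReal.ofReal (|W10.val u x| ^ pInfty p) ≠ ∞ := by
  unfold pInfty
  rcases le_total (sobolevExp p) (⨆ i, p i) with h | h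
  · rw [max_eq_right h]
    have : Nonempty (Fin N) := ⟨⟨0, by omega⟩⟩
    obtain ⟨i, hi⟩ := exists_eq_ciSup_of_finite (f := p)
    rw [← hi]
    exact W10.lintegral_rpow_ne_top hΩ u i
  · rw [max_eq_left h]
    exact W10.lintegral_sobolev_ne_top hN hpN hΩ.measure_lt_top.ne u

end Embeddings

end

/-! ### The truncation, integrability of the terms, and admissible test functions -/

section

open Filter Topology

/-- A smooth version of the truncation `min (max (-s) 0) ε`. -/
def negTrunc (ε s : ℝ) : ℝ := ε * Real.smoothTransition (-s / ε)

section NegTrunc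

theorem contDiff_negTrunc (ε : ℝ) {n : ℕ∞} : ContDiff ℝ n (negTrunc ε) :=
  contDiff_const.mul (Real.smoothTransition.contDiff.comp (contDiff_neg.div_const ε))

theorem negTrunc_nonneg {ε : ℝ} (hε : 0 < ε) (s : ℝ) : 0 ≤ negTrunc ε s :=
  mul_nonneg hε.le (Real.smoothTransition.nonneg _)

theorem negTrunc_le {ε : ℝ} (hε : 0 < ε) (s : ℝ) : negTrunc ε s ≤ ε :=
  mul_le_of_le_one_right hε.le (Real.smoothTransition.le_one _)

theorem negTrunc_of_nonneg {ε s : ℝ} (hε : 0 < ε) (hs : 0 ≤ s) : negTrunc ε s = 0 := by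
  rw [negTrunc, Real.smoothTransition.zero_of_nonpos, mul_zero]
  exact div_nonpos_of_nonpos_of_nonneg (by linarith) hε.le

theorem negTrunc_of_le {ε s : ℝ} (hε : 0 < ε) (hs : s ≤ -ε) : negTrunc ε s = ε := by
  rw [negTrunc, Real.smoothTransition.one_of_one_le, mul_one]
  rw [one_le_div hε]
  linarith

/-- The outer factor `ε` cancels the inner `1/ε`. Hence one bound for the derivative serves all `ε`,
as the limit `ε → 0` requires. -/
theorem deriv_negTrunc {ε : ℝ} (hε : 0 < ε) (s : ℝ) :
    deriv (negTrunc ε) s = -deriv Real.smoothTransition (-s / ε) := by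
  have h1 : HasDerivAt Real.smoothTransition (deriv Real.smoothTransition (-s / ε)) (-s / ε) :=
    ((Real.smoothTransition.contDiff (n := 1)).differentiable one_ne_zero _).hasDerivAt
  have h2 : HasDerivAt (fun s : ℝ => -s / ε) (-1 / ε) s := (hasDerivAt_neg s).div_const ε
  have h3 := (h1.comp s h2).const_mul ε
  have h4 : HasDerivAt (negTrunc ε) (ε * (deriv Real.smoothTransition (-s / ε) * (-1 / ε))) s := h3
  rw [h4.deriv]
  field_simp

/-- Each such point is a global minimum; this covers the endpoint `0` as well. -/
theorem deriv_smoothTransition_of_nonpos {s : ℝ} (hs : s ≤ 0) :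
    deriv Real.smoothTransition s = 0 := by
  refine IsLocalMin.deriv_eq_zero (.of_forall fun t => ?_)
  rw [Real.smoothTransition.zero_of_nonpos hs]
  exact Real.smoothTransition.nonneg t

theorem deriv_smoothTransition_of_one_le {s : ℝ} (hs : 1 ≤ s) :
    deriv Real.smoothTransition s = 0 := by
  refine IsLocalMax.deriv_eq_zero (.of_forall fun t => ?_)
  rw [Real.smoothTransition.one_of_one_le hs]
  exact Real.smoothTransition.le_one t

theorem exists_deriv_smoothTransition_le :
    ∃ C : ℝ, 0 < C ∧ ∀ s, |deriv Real.smoothTransition s| ≤ C := by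
  have hc : Continuous (deriv Real.smoothTransition) :=
    (Real.smoothTransition.contDiff (n := 1)).continuous_deriv le_rfl
  obtain ⟨C, hC⟩ := (isCompact_Icc (a := (0 : ℝ)) (b := 1)).exists_bound_of_continuousOn
    hc.continuousOn
  refine ⟨max C 1, by positivity, fun s => ?_⟩
  by_cases hs : s ∈ Icc (0 : ℝ) 1
  · exact (hC s hs).trans (le_max_left _ _)
  · have : deriv Real.smoothTransition s = 0 := by
      rcases lt_or_ge s 0 with h | h
      · exact deriv_smoothTransition_of_nonpos h.le
      · exact deriv_smoothTransition_of_one_le (not_lt.1 fun h' => hs ⟨h, h'.le⟩)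
    rw [this, abs_zero]
    positivity

theorem deriv_negTrunc_nonpos {ε : ℝ} (hε : 0 < ε) (s : ℝ) : deriv (negTrunc ε) s ≤ 0 := by
  rw [deriv_negTrunc hε, neg_nonpos]
  exact Real.smoothTransition.monotone.deriv_nonneg

theorem deriv_negTrunc_eq_zero {ε s : ℝ} (hε : 0 < ε) (hs : ¬(-ε < s ∧ s < 0)) :
    deriv (negTrunc ε) s = 0 := by
  rw [deriv_negTrunc hε, neg_eq_zero]
  rcases le_or_gt 0 s with h | h
  · exact deriv_smoothTransition_of_nonpos
      (div_nonpos_of_nonpos_of_nonneg (by linarith) hε.le)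
  · refine deriv_smoothTransition_of_one_le ?_
    rw [one_le_div hε]
    have := not_lt.1 fun h' => hs ⟨h', h⟩
    linarith

end NegTrunc

section Lebesgue

variable {α : Type*} [MeasurableSpace α] {μ : Measure α} {f : α → ℝ} {q : ℝ}

theorem memLp_iff_lintegral_ne_top (hq : 0 < q) (hf : AEStronglyMeasurable f μ) :
    MemLp f (ENNReal.ofReal q) μ ↔ ∫⁻ x, ENNReal.ofReal (|f x| ^ q) ∂μ ≠ ∞ := by
  have e : ∫⁻ x, ENNReal.ofReal (|f x| ^ q) ∂μ = ∫⁻ x, ‖f x‖ₑ ^ q ∂μ := by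
    refine lintegral_congr fun x => ?_
    rw [Real.enorm_eq_ofReal_abs, ENNReal.ofReal_rpow_of_nonneg (abs_nonneg _) hq.le]
  rw [MemLp, eLpNorm_lt_top_iff_lintegral_rpow_enorm_lt_top (by simpa using hq)
    ENNReal.ofReal_ne_top, ENNReal.toReal_ofReal hq.le, e, lt_top_iff_ne_top]
  exact and_iff_right hf

theorem integrable_of_lintegral_ofReal_ne_top (hf : AEStronglyMeasurable f μ) (h0 : ∀ x, 0 ≤ f x)
    (h : ∫⁻ x, ENNReal.ofReal (f x) ∂μ ≠ ∞) : Integrable f μ :=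
  ⟨hf, (hasFiniteIntegral_iff_ofReal (.of_forall h0)).2 h.lt_top⟩

end Lebesgue

variable {N : ℕ} {Ω : Opens (EuclideanSpace ℝ (Fin N))} {p : Fin N → ℝ} [hp : ∀ i, Fact (1 < p i)]

theorem holderConjugate_conjExp {q : ℝ} (hq : 1 < q) :
    (ENNReal.ofReal (conjExp q)).HolderConjugate (ENNReal.ofReal q) :=
  (Real.HolderConjugate.conjExponent hq).symm.ennrealOfReal

theorem conjExp_pos {q : ℝ} (hq : 1 < q) : 0 < conjExp q := by
  have : 0 < q - 1 := by linarith
  unfold conjExp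
  positivity

theorem W10.aestronglyMeasurable_grad (u : W10 Ω p) : AEStronglyMeasurable (W10.grad u)
    (volume.restrict (Ω : Set (EuclideanSpace ℝ (Fin N)))) :=
  (aemeasurable_pi_iff.2 fun i => (W10.memLp_grad u i).1.aemeasurable).aestronglyMeasurable

/-- The growth exponent fits because `(pᵢ - 1) pᵢ' = pᵢ`. -/
theorem HypA.memLp {A : Fin N → EuclideanSpace ℝ (Fin N) → (Fin N → ℝ) → ℝ} {α : ℝ}
    {β : Fin N → ℝ} (hA : HypA Ω p A α β) (u : W10 Ω p) (i : Fin N) :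
    MemLp (fun x => A i x (W10.grad u x)) (ENNReal.ofReal (conjExp (p i)))
      (volume.restrict (Ω : Set (EuclideanSpace ℝ (Fin N)))) := by
  have hp1 : 1 < p i := (hp i).out
  have hc := conjExp_pos hp1
  have hβ : 0 ≤ β i := hA.alpha_pos.le.trans (hA.alpha_le i)
  have hg := (memLp_iff_lintegral_ne_top (by linarith : 0 < p i) (W10.memLp_grad u i).1).1
    (W10.memLp_grad u i)
  rw [memLp_iff_lintegral_ne_top hc
    ((hA.caratheodory i).aestronglyMeasurable_comp (W10.aestronglyMeasurable_grad u))]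
  have hle : ∫⁻ x in Ω, ENNReal.ofReal (|A i x (W10.grad u x)| ^ conjExp (p i)) ≤
      ∫⁻ x in Ω, ENNReal.ofReal (β i ^ conjExp (p i)) *
        ENNReal.ofReal (|W10.grad u x i| ^ p i) := by
    refine lintegral_mono_ae ?_
    filter_upwards [hA.growth i] with x hx
    rw [← ENNReal.ofReal_mul (by positivity)]
    refine ENNReal.ofReal_le_ofReal ?_
    refine (Real.rpow_le_rpow (abs_nonneg _) (hx _) hc.le).trans (le_of_eq ?_)
    rw [Real.mul_rpow hβ (by positivity), ← Real.rpow_mul (abs_nonneg _)]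
    congr 2
    have : p i - 1 ≠ 0 := by linarith
    rw [conjExp]
    field_simp
  refine (hle.trans_lt ?_).ne
  rw [lintegral_const_mul' _ _ ENNReal.ofReal_ne_top]
  exact ENNReal.mul_lt_top ENNReal.ofReal_lt_top hg.lt_top

/-- Serves both the integrability of the convection term and, with `|s| ≤ ε`, the gain `ε^{p̄}` in
the energy estimate. -/
theorem HypB.abs_rpow_le {q : ℝ} (hq : 1 < q) {B b s r : ℝ}
    (h : |B| ≤ b * |s| ^ (r / conjExp q)) :
    |B| ^ conjExp q ≤ |b| ^ conjExp q * |s| ^ r := by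
  have hc := conjExp_pos hq
  have h2 : |B| ≤ |b| * |s| ^ (r / conjExp q) :=
    h.trans (mul_le_mul_of_nonneg_right (le_abs_self b) (by positivity))
  refine (Real.rpow_le_rpow (abs_nonneg _) h2 hc.le).trans (le_of_eq ?_)
  rw [Real.mul_rpow (abs_nonneg _) (by positivity), ← Real.rpow_mul (abs_nonneg _),
    div_mul_cancel₀ _ hc.ne']

/-- The point where the Lorentz refinement is spent: `|bᵢ|^{pᵢ'}` is in weak `L^{N/p̄}`, whose
natural partner is `|u|^{p̄}` in the Lorentz space `L^{N/(N-p̄), 1}`. -/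
theorem HypB.memLp (hN : 2 ≤ N) (hpN : harmonicMean p < N)
    (hΩ : volume (Ω : Set (EuclideanSpace ℝ (Fin N))) ≠ ∞)
    {B : Fin N → EuclideanSpace ℝ (Fin N) → ℝ → ℝ} {b : Fin N → EuclideanSpace ℝ (Fin N) → ℝ}
    (hB : HypB Ω p B b) (u : W10 Ω p) (i : Fin N) :
    MemLp (fun x => B i x (W10.val u x)) (ENNReal.ofReal (conjExp (p i)))
      (volume.restrict (Ω : Set (EuclideanSpace ℝ (Fin N)))) := by
  have hp1 : 1 < p i := (hp i).out
  have hc := conjExp_pos hp1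
  rw [memLp_iff_lintegral_ne_top hc
    ((hB.caratheodory i).aestronglyMeasurable_comp (W10.memLp_val u).1)]
  refine ((lintegral_mono_ae ?_).trans_lt
    (W10.lintegral_weight_ne_top hN hpN hΩ hc (hB.memWeakLp i) u).lt_top).ne
  filter_upwards [hB.growth i] with x hx
  rw [← ENNReal.ofReal_mul (by positivity)]
  exact ENNReal.ofReal_le_ofReal (HypB.abs_rpow_le hp1 (hx _))

/-- Since `γ < p_∞`, `|u|^γ ≤ 1 + |u|^{p_∞}`. Integrability alone is enough because the test
functions to be used are bounded. -/
theorem HypG.integrable (hN : 2 ≤ N) (hpN : harmonicMean p < N)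
    (hΩ : Bornology.IsBounded (Ω : Set (EuclideanSpace ℝ (Fin N))))
    {G : EuclideanSpace ℝ (Fin N) → ℝ → ℝ} {m γ : ℝ} (hG : HypG Ω p G m γ) (u : W10 Ω p) :
    Integrable (fun x => G x (W10.val u x))
      (volume.restrict (Ω : Set (EuclideanSpace ℝ (Fin N)))) := by
  have hm := hG.caratheodory.aestronglyMeasurable_comp (W10.memLp_val u).1
  have hγ := hG.gamma_lt
  have hγ1 := hG.one_le_gamma
  have hpos : 0 < pInfty p := by linarith
  have hI := integrable_of_lintegral_ofReal_ne_top
    ((continuous_abs.comp_aestronglyMeasurable (W10.memLp_val u).1).aemeasurable.pow_const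
      (pInfty p)).aestronglyMeasurable (fun x => by positivity)
    (W10.lintegral_pInfty_ne_top hN hpN hΩ u)
  have h1 : IntegrableOn (fun _ : EuclideanSpace ℝ (Fin N) => (1 : ℝ)) Ω :=
    integrableOn_const hΩ.measure_lt_top.ne
  refine ((Integrable.add h1 hI).const_mul m).mono' hm ?_
  filter_upwards [hG.growth] with x hx
  refine (hx _).trans (mul_le_mul_of_nonneg_left ?_ hG.mu_nonneg)
  simp only [Pi.add_apply]
  rcases le_total |W10.val u x| 1 with h | h
  · have := Real.rpow_le_one (abs_nonneg _) h (by linarith : 0 ≤ γ)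
    have : 0 ≤ |W10.val u x| ^ pInfty p := by positivity
    linarith
  · have := Real.rpow_le_rpow_of_exponent_le h (by linarith : γ ≤ pInfty p)
    linarith

/-- A weak supersolution may be tested with `H(u)` for smooth bounded `H ≥ 0` with `H(0) = 0` and
bounded derivative. -/
theorem IsWeakSolution.integral_comp_nonneg
    {A : Fin N → EuclideanSpace ℝ (Fin N) → (Fin N → ℝ) → ℝ}
    {B : Fin N → EuclideanSpace ℝ (Fin N) → ℝ → ℝ} {G : EuclideanSpace ℝ (Fin N) → ℝ → ℝ}
    {F : StrongDual ℝ (W10 Ω p)} {u : W10 Ω p} (hu : IsWeakSolution A B G F u)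
    (hF : DualNonneg F)
    (hA : ∀ i, MemLp (fun x => A i x (W10.grad u x)) (ENNReal.ofReal (conjExp (p i)))
      (volume.restrict (Ω : Set (EuclideanSpace ℝ (Fin N)))))
    (hB : ∀ i, MemLp (fun x => B i x (W10.val u x)) (ENNReal.ofReal (conjExp (p i)))
      (volume.restrict (Ω : Set (EuclideanSpace ℝ (Fin N)))))
    (hG : Integrable (fun x => G x (W10.val u x))
      (volume.restrict (Ω : Set (EuclideanSpace ℝ (Fin N)))))
    {H : ℝ → ℝ} (hH : ContDiff ℝ ((⊤ : ℕ∞) : WithTop ℕ∞) H) (h0 : H 0 = 0) {c C : ℝ}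
    (hH0 : ∀ s, 0 ≤ H s) (hHc : ∀ s, H s ≤ c) (hC : ∀ s, |deriv H s| ≤ C) :
    Integrable (fun x => (∑ i, (A i x (W10.grad u x) + B i x (W10.val u x)) *
      (deriv H (W10.val u x) * W10.grad u x i)) + G x (W10.val u x) * H (W10.val u x))
      (volume.restrict (Ω : Set (EuclideanSpace ℝ (Fin N)))) ∧
    0 ≤ ∫ x in Ω, ((∑ i, (A i x (W10.grad u x) + B i x (W10.val u x)) *
      (deriv H (W10.val u x) * W10.grad u x i)) + G x (W10.val u x) * H (W10.val u x)) := by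
  set μ := volume.restrict (Ω : Set (EuclideanSpace ℝ (Fin N))) with hμ
  obtain ⟨φ, -, t1, t2, t3⟩ := W10.exists_test_seq u
  obtain ⟨s1, s2, s3⟩ := tendsto_compTest hH h0 hC t1 t2 t3
  have hHm : AEStronglyMeasurable (fun x => H (W10.val u x)) μ :=
    hH.continuous.comp_aestronglyMeasurable (W10.memLp_val u).1
  have hC0 : 0 ≤ C := (abs_nonneg _).trans (hC 0)
  have hH1 : MemLp (fun x => H (W10.val u x)) 1 μ := by
    refine ((W10.memLp_val u).const_mul C).mono hHm (.of_forall fun x => ?_)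
    have := Convex.norm_image_sub_le_of_norm_deriv_le (f := H) (s := univ) (C := C)
      (fun x _ => (hH.differentiable (by simp)) x) (fun x _ => hC x) convex_univ
      (mem_univ 0) (mem_univ (W10.val u x))
    rw [h0, sub_zero, sub_zero] at this
    rwa [norm_mul, Real.norm_of_nonneg hC0]
  -- `w` represents `H(u)` in `W₀^{1,p⃗}(Ω)`. The sign of `F` is used only on this limit: `H ∘ φ n`
  -- is an approximation in norm.
  obtain ⟨w, hw, hwlim⟩ := W10.exists_of_tendsto hH1 s2 s1 s3
  have hFw : 0 ≤ F w := by
    refine hF w ?_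
    filter_upwards [hw] with x hx
    rw [hx]
    exact hH0 _
  have hFlim : Tendsto (fun n => F (testW10 Ω p (compTest hH h0 (φ n)))) atTop (𝓝 (F w)) :=
    (F.continuous.tendsto w).comp hwlim
  have hconj : ∀ i, (ENNReal.ofReal (conjExp (p i))).HolderConjugate (ENNReal.ofReal (p i)) :=
    fun i => holderConjugate_conjExp (hp i).out
  have hAB : ∀ i, MemLp (fun x => A i x (W10.grad u x) + B i x (W10.val u x))
      (ENNReal.ofReal (conjExp (p i))) μ := fun i => (hA i).add (hB i)
  have hlimA : ∀ i, Tendsto (fun n => ∫ x, (A i x (W10.grad u x) + B i x (W10.val u x)) *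
      partialDeriv i (compTest hH h0 (φ n)) x ∂μ) atTop
      (𝓝 (∫ x, (A i x (W10.grad u x) + B i x (W10.val u x)) *
        (deriv H (W10.val u x) * W10.grad u x i) ∂μ)) := fun i =>
    haveI := hconj i
    tendsto_integral_mul (hAB i) (fun n => memLp_partialDeriv Ω i _ _) (s2 i) (s3 i)
  have hHb : ∀ s, ‖H s‖ ≤ c := fun s => by
    rw [Real.norm_of_nonneg (hH0 s)]
    exact hHc s
  have hlimG : Tendsto (fun n => ∫ x, G x (W10.val u x) * compTest hH h0 (φ n) x ∂μ) atTop
      (𝓝 (∫ x, G x (W10.val u x) * H (W10.val u x) ∂μ)) := by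
    refine tendsto_integral_of_dominated_convergence (fun x => ‖G x (W10.val u x)‖ * c)
      (fun n => hG.1.mul (compTest hH h0 (φ n)).continuous.aestronglyMeasurable)
      (hG.norm.mul_const c) (fun n => .of_forall fun x => ?_) ?_
    · rw [norm_mul]
      gcongr
      exact hHb _
    · filter_upwards [t3] with x hx
      exact ((hH.continuous.tendsto _).comp hx).const_mul _
  have hsplit : ∀ (f : Fin N → EuclideanSpace ℝ (Fin N) → ℝ) (g : EuclideanSpace ℝ (Fin N) → ℝ),
      (∀ i, MemLp (f i) (ENNReal.ofReal (p i)) μ) → AEStronglyMeasurable g μ →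
      (∀ x, ‖g x‖ ≤ c) →
      Integrable (fun x => (∑ i, (A i x (W10.grad u x) + B i x (W10.val u x)) * f i x) +
        G x (W10.val u x) * g x) μ ∧
      ∫ x, ((∑ i, (A i x (W10.grad u x) + B i x (W10.val u x)) * f i x) +
        G x (W10.val u x) * g x) ∂μ =
      (∑ i, ∫ x, (A i x (W10.grad u x) + B i x (W10.val u x)) * f i x ∂μ) +
        ∫ x, G x (W10.val u x) * g x ∂μ := by
    intro f g hf hg hgc
    have j1 : ∀ i, Integrable (fun x =>
        (A i x (W10.grad u x) + B i x (W10.val u x)) * f i x) μ := fun i =>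
      haveI := hconj i
      (hAB i).integrable_mul (hf i)
    have j2 : Integrable (fun x => G x (W10.val u x) * g x) μ :=
      hG.mul_bdd (c := c) hg (.of_forall hgc)
    refine ⟨(integrable_finsetSum _ fun i _ => j1 i).add j2, ?_⟩
    rw [integral_add (integrable_finsetSum _ fun i _ => j1 i) j2,
      integral_finsetSum _ fun i _ => j1 i]
  obtain ⟨hint, heq⟩ := hsplit _ _ s2 hHm fun x => hHb _
  refine ⟨hint, ?_⟩
  rw [heq]
  have hlim := (tendsto_finsetSum Finset.univ fun i _ => hlimA i).add hlimG
  refine hFw.trans (le_of_eq (tendsto_nhds_unique hFlim (hlim.congr fun n => ?_)))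
  rw [← hu (compTest hH h0 (φ n))]
  exact (hsplit _ (compTest hH h0 (φ n)) (fun i => memLp_partialDeriv Ω i _ _)
    (compTest hH h0 (φ n)).continuous.aestronglyMeasurable fun x => hHb _).2.symm

/-- Integration by parts of a composition against a coordinate function. -/
theorem W10.integral_comp_eq (hΩ : Bornology.IsBounded (Ω : Set (EuclideanSpace ℝ (Fin N))))
    (u : W10 Ω p) (i : Fin N)
    {H : ℝ → ℝ} (hH : ContDiff ℝ ((⊤ : ℕ∞) : WithTop ℕ∞) H) (h0 : H 0 = 0) {c C : ℝ}
    (hHc : ∀ s, |H s| ≤ c) (hC : ∀ s, |deriv H s| ≤ C) :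
    ∫ x in Ω, H (W10.val u x) = -∫ x in Ω, x i * (deriv H (W10.val u x) * W10.grad u x i) := by
  set μ := volume.restrict (Ω : Set (EuclideanSpace ℝ (Fin N))) with hμ
  have : IsFiniteMeasure μ := ⟨by simpa [hμ] using hΩ.measure_lt_top⟩
  obtain ⟨φ, -, t1, t2, t3⟩ := W10.exists_test_seq u
  obtain ⟨s1, s2, s3⟩ := tendsto_compTest hH h0 hC t1 t2 t3
  obtain ⟨R, hR, hΩR⟩ := exists_coord_bound hΩ
  have := holderConjugate_conjExp (hp i).out
  -- On a bounded set the coordinate lies in the conjugate space, so integration by parts passes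
  -- from `H ∘ φ n` to `H(u)`.
  have hcoord : MemLp (fun x : EuclideanSpace ℝ (Fin N) => x i)
      (ENNReal.ofReal (conjExp (p i))) μ := by
    refine MemLp.of_bound (EuclideanSpace.proj i :
      EuclideanSpace ℝ (Fin N) →L[ℝ] ℝ).continuous.aestronglyMeasurable R ?_
    exact (ae_restrict_iff' Ω.isOpen.measurableSet).2 (.of_forall fun x hx => hΩR x hx i)
  have l1 := tendsto_integral_mul hcoord
    (fun n => memLp_partialDeriv Ω i (compTest hH h0 (φ n)) _) (s2 i) (s3 i)
  have l2 : Tendsto (fun n => ∫ x, compTest hH h0 (φ n) x ∂μ) atTop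
      (𝓝 (∫ x, H (W10.val u x) ∂μ)) := by
    refine tendsto_integral_of_dominated_convergence (fun _ => c)
      (fun n => (compTest hH h0 (φ n)).continuous.aestronglyMeasurable)
      (integrable_const c) (fun n => .of_forall fun x => hHc _) ?_
    filter_upwards [t3] with x hx using (hH.continuous.tendsto _).comp hx
  refine tendsto_nhds_unique l2 (l1.neg.congr fun n => ?_)
  set ψ := compTest hH h0 (φ n)
  rw [setIntegral_eq_integral_of_forall_compl_eq_zero, setIntegral_eq_integral_of_forall_compl_eq_zero,
    integral_eq_neg_integral_coord_mul (ψ.contDiff.of_le (by simp)) ψ.hasCompactSupport i]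
  · exact fun x hx => image_eq_zero_of_notMem_tsupport fun h => hx (ψ.tsupport_subset h)
  · intro x hx
    have : partialDeriv i ψ x = 0 := by
      refine image_eq_zero_of_notMem_tsupport fun h => hx (ψ.tsupport_subset ?_)
      exact tsupport_fderiv_apply_subset ℝ (EuclideanSpace.single i 1) h
    rw [this, mul_zero]

end

/-! ### Energy of the negative part at low levels -/

section

open Filter Topology

variable {N : ℕ} {Ω : Opens (EuclideanSpace ℝ (Fin N))} {p : Fin N → ℝ} [hp : ∀ i, Fact (1 < p i)]

/-- Absorption of the convection term by Young's inequality. -/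
theorem abs_mul_le_of_abs_le {q r α B b s t : ℝ} (hq : 1 < q) (hα : 0 < α)
    (h : |B| ≤ b * |s| ^ (r / conjExp q)) :
    |B| * |t| ≤ α / 2 * |t| ^ q + (α / 2) ^ (1 / (1 - q)) * (|b| ^ conjExp q * |s| ^ r) := by
  have hq1 : 0 < q - 1 := by linarith
  -- The solution of `κ^{1-q} = α/2`: the gradient term of Young's inequality then costs half of the
  -- coercivity constant. The inequality is applied with `|B|^{1/(q-1)}`, whose `q`-th power is
  -- `|B|^{q'}`.
  set κ : ℝ := (α / 2) ^ (1 / (1 - q)) with hκ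
  have hκ0 : 0 < κ := by positivity
  have h1 := rpow_sub_one_mul_le hq hκ0 (a := |B| ^ (1 / (q - 1))) (by positivity) (abs_nonneg t)
  rw [← Real.rpow_mul (abs_nonneg _), ← Real.rpow_mul (abs_nonneg _),
    one_div_mul_cancel hq1.ne', Real.rpow_one, hκ, ← Real.rpow_mul (by positivity),
    one_div_mul_cancel (by linarith), Real.rpow_one, one_div_mul_eq_div, ← hκ] at h1
  have h2 := HypB.abs_rpow_le hq h
  rw [← conjExp] at h1
  have h3 : κ * |B| ^ conjExp q ≤ κ * (|b| ^ conjExp q * |s| ^ r) := by gcongr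
  linarith

/-- Pointwise estimate of the flux against the gradient of the truncation. -/
theorem flux_mul_le {q r α a B b s t ε C w : ℝ} (hq : 1 < q) (hr : 0 ≤ r) (hα : 0 < α)
    (hε : 0 < ε) (hC : ∀ s, |deriv (negTrunc ε) s| ≤ C) (ha : α * |t| ^ q ≤ a * t)
    (hB : |B| ≤ b * |s| ^ (r / conjExp q)) (hw : -ε < s ∧ s < 0 → |b| ^ conjExp q ≤ w)
    (hw0 : 0 ≤ w) :
    (a + B) * (deriv (negTrunc ε) s * t) ≤
      -(α / 2) * (|deriv (negTrunc ε) s| * |t| ^ q) +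
        C * ε ^ r * ((α / 2) ^ (1 / (1 - q)) * w) := by
  have e : deriv (negTrunc ε) s = -|deriv (negTrunc ε) s| := by
    rw [abs_of_nonpos (deriv_negTrunc_nonpos hε _), neg_neg]
  have hD0 : 0 ≤ |deriv (negTrunc ε) s| := abs_nonneg _
  have hDC := hC s
  have hC0 : 0 ≤ C := hD0.trans hDC
  have y2 := abs_mul_le_of_abs_le (t := t) hq hα hB
  have y3 : -(B * t) ≤ |B| * |t| := by
    rw [← abs_mul]
    exact neg_le_abs _
  set κ := (α / 2) ^ (1 / (1 - q)) with hκ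
  have hκ0 : 0 ≤ κ := by positivity
  have y5 : |deriv (negTrunc ε) s| * (-(a * t) - B * t) ≤
      |deriv (negTrunc ε) s| * (-(α / 2) * |t| ^ q + κ * (|b| ^ conjExp q * |s| ^ r)) :=
    mul_le_mul_of_nonneg_left (by linarith) hD0
  -- The derivative vanishes off `(-ε, 0)`, and on this interval `|s| ≤ ε`.
  have y6 : |deriv (negTrunc ε) s| * |s| ^ r * |b| ^ conjExp q ≤ C * ε ^ r * w := by
    by_cases hx : -ε < s ∧ s < 0
    · have h1 : |s| ≤ ε := abs_le.2 ⟨hx.1.le, hx.2.le.trans hε.le⟩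
      have h2 := hw hx
      gcongr
    · rw [deriv_negTrunc_eq_zero hε hx, abs_zero, zero_mul, zero_mul]
      positivity
  have y7 := mul_le_mul_of_nonneg_left y6 hκ0
  rw [e, abs_neg, abs_abs]
  linarith

theorem W10.integrable_grad_rpow (u : W10 Ω p) (i : Fin N) :
    Integrable (fun x => |W10.grad u x i| ^ p i)
      (volume.restrict (Ω : Set (EuclideanSpace ℝ (Fin N)))) :=
  integrable_of_lintegral_ofReal_ne_top
    ((continuous_abs.comp_aestronglyMeasurable (W10.memLp_grad u i).1).aemeasurable.pow_const
      (p i)).aestronglyMeasurable (fun x => by positivity)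
    ((memLp_iff_lintegral_ne_top (zero_lt_one.trans (hp i).out) (W10.memLp_grad u i).1).1
      (W10.memLp_grad u i))

theorem HypB.integrable_rpow {B : Fin N → EuclideanSpace ℝ (Fin N) → ℝ → ℝ}
    {b : Fin N → EuclideanSpace ℝ (Fin N) → ℝ} (hB : HypB Ω p B b) (hN : 2 ≤ N)
    (hpN : harmonicMean p < N) (hΩ : volume (Ω : Set (EuclideanSpace ℝ (Fin N))) ≠ ∞)
    (i : Fin N) : Integrable (fun x => |b i x| ^ conjExp (p i))
      (volume.restrict (Ω : Set (EuclideanSpace ℝ (Fin N)))) := by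
  have hc := conjExp_pos (hp i).out
  have hq0 : 0 < harmonicMean p := harmonicMean_pos (by omega) fun i => (hp i).out
  refine integrable_of_lintegral_ofReal_ne_top
    ((continuous_abs.measurable.comp_aemeasurable (hB.memWeakLp i).1).pow_const
      _).aestronglyMeasurable (fun x => by positivity)
    ((hB.memWeakLp i).lintegral_ne_top hc ?_ hΩ)
  rw [lt_div_iff₀ hq0, mul_comm]
  exact mul_lt_mul_of_pos_right hpN hc

set_option maxHeartbeats 400000 in
/-- The energy of the negative part of `u` at low levels. -/
theorem IsWeakSolution.energy_le
    {A : Fin N → EuclideanSpace ℝ (Fin N) → (Fin N → ℝ) → ℝ}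
    {B : Fin N → EuclideanSpace ℝ (Fin N) → ℝ → ℝ} {G : EuclideanSpace ℝ (Fin N) → ℝ → ℝ}
    {F : StrongDual ℝ (W10 Ω p)} {u : W10 Ω p} (hu : IsWeakSolution A B G F u)
    (hF : DualNonneg F) (hN : 2 ≤ N) (hpN : harmonicMean p < N)
    (hΩ : Bornology.IsBounded (Ω : Set (EuclideanSpace ℝ (Fin N))))
    {α : ℝ} {β : Fin N → ℝ} (hA : HypA Ω p A α β)
    {b : Fin N → EuclideanSpace ℝ (Fin N) → ℝ} (hB : HypB Ω p B b)
    (hG : Integrable (fun x => G x (W10.val u x))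
      (volume.restrict (Ω : Set (EuclideanSpace ℝ (Fin N)))))
    (hGs : ∀ᵐ x ∂(volume.restrict (Ω : Set (EuclideanSpace ℝ (Fin N)))), ∀ s : ℝ, 0 ≤ G x s * s)
    {C : ℝ} (hC : ∀ s, |deriv Real.smoothTransition s| ≤ C) {ε : ℝ} (hε : 0 < ε) (j : Fin N) :
    α / 2 * ∫ x in Ω, |deriv (negTrunc ε) (W10.val u x)| * |W10.grad u x j| ^ p j ≤
      C * ε ^ harmonicMean p * ∑ i, (α / 2) ^ (1 / (1 - p i)) *
        ∫ x in Ω, {x | -ε < W10.val u x ∧ W10.val u x < 0}.indicator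
          (fun x => |b i x| ^ conjExp (p i)) x := by
  set μ := volume.restrict (Ω : Set (EuclideanSpace ℝ (Fin N))) with hμ
  set q := harmonicMean p with hq
  set Z := {x | -ε < W10.val u x ∧ W10.val u x < 0} with hZ
  set D : EuclideanSpace ℝ (Fin N) → ℝ := fun x => |deriv (negTrunc ε) (W10.val u x)| with hD
  have hα := hA.alpha_pos
  have hq0 : 0 < q := harmonicMean_pos (by omega) fun i => (hp i).out
  have hHC : ∀ s, |deriv (negTrunc ε) s| ≤ C := fun s => by
    rw [deriv_negTrunc hε, abs_neg]
    exact hC _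
  have hC0 : 0 ≤ C := (abs_nonneg _).trans (hC 0)
  have hvm := (W10.memLp_val u).1.aemeasurable
  have hZm : NullMeasurableSet Z μ :=
    (nullMeasurableSet_lt aemeasurable_const hvm).inter
      (nullMeasurableSet_lt hvm aemeasurable_const)
  obtain ⟨hL, key⟩ := hu.integral_comp_nonneg hF (hA.memLp u) (hB.memLp hN hpN hΩ.measure_lt_top.ne u) hG
    (contDiff_negTrunc ε) (negTrunc_of_nonneg hε le_rfl) (negTrunc_nonneg hε) (negTrunc_le hε) hHC
  have hDm : AEStronglyMeasurable D μ :=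
    ((contDiff_negTrunc ε (n := 1)).continuous_deriv le_rfl).abs.comp_aestronglyMeasurable
      (W10.memLp_val u).1
  have hI1 : ∀ i, Integrable (fun x => D x * |W10.grad u x i| ^ p i) μ := by
    intro i
    exact (W10.integrable_grad_rpow u i).bdd_mul (c := C) hDm (.of_forall fun x => by
      rw [Real.norm_eq_abs, abs_abs]
      exact hHC _)
  have hI2 : ∀ i, Integrable (Z.indicator fun x => |b i x| ^ conjExp (p i)) μ := fun i =>
    (hB.integrable_rpow hN hpN hΩ.measure_lt_top.ne i).indicator₀ hZm
  have hle : ∀ᵐ x ∂μ, ((∑ i, (A i x (W10.grad u x) + B i x (W10.val u x)) *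
      (deriv (negTrunc ε) (W10.val u x) * W10.grad u x i)) +
        G x (W10.val u x) * negTrunc ε (W10.val u x)) ≤
      ∑ i, (-(α / 2) * (D x * |W10.grad u x i| ^ p i) + C * ε ^ q * ((α / 2) ^ (1 / (1 - p i)) *
        Z.indicator (fun x => |b i x| ^ conjExp (p i)) x)) := by
    filter_upwards [ae_all_iff.2 hA.coercive, ae_all_iff.2 hB.growth, hGs] with x hxA hxB hxG
    -- The truncation is supported where `u < 0`, and there the sign condition forces `G ≤ 0`.
    have hGle : G x (W10.val u x) * negTrunc ε (W10.val u x) ≤ 0 := by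
      rcases le_or_gt 0 (W10.val u x) with h | h
      · rw [negTrunc_of_nonneg hε h, mul_zero]
      · have := hxG (W10.val u x)
        have : G x (W10.val u x) ≤ 0 := by
          by_contra! h'
          nlinarith
        exact mul_nonpos_of_nonpos_of_nonneg this (negTrunc_nonneg hε _)
    have := Finset.sum_le_sum fun i (_ : i ∈ Finset.univ) =>
      flux_mul_le (hp i).out hq0.le hα hε hHC (hxA i (W10.grad u x)) (hxB i (W10.val u x))
        (w := Z.indicator (fun x => |b i x| ^ conjExp (p i)) x)
        (fun h => (indicator_of_mem (s := Z) (a := x) h fun x => |b i x| ^ conjExp (p i)).ge)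
        (indicator_nonneg (fun x _ => by positivity) x)
    linarith
  have hIr : ∀ i, Integrable (fun x => -(α / 2) * (D x * |W10.grad u x i| ^ p i) +
      C * ε ^ q * ((α / 2) ^ (1 / (1 - p i)) *
        Z.indicator (fun x => |b i x| ^ conjExp (p i)) x)) μ := fun i =>
    ((hI1 i).const_mul _).add (((hI2 i).const_mul _).const_mul _)
  have hfin : 0 ≤ ∫ x, ∑ i, (-(α / 2) * (D x * |W10.grad u x i| ^ p i) +
      C * ε ^ q * ((α / 2) ^ (1 / (1 - p i)) *
        Z.indicator (fun x => |b i x| ^ conjExp (p i)) x)) ∂μ :=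
    key.trans (integral_mono_ae hL (integrable_finsetSum _ fun i _ => hIr i) hle)
  rw [integral_finsetSum _ fun i _ => hIr i] at hfin
  have hsplit : ∀ i, ∫ x, (-(α / 2) * (D x * |W10.grad u x i| ^ p i) +
      C * ε ^ q * ((α / 2) ^ (1 / (1 - p i)) *
        Z.indicator (fun x => |b i x| ^ conjExp (p i)) x)) ∂μ =
      -(α / 2 * ∫ x, D x * |W10.grad u x i| ^ p i ∂μ) + C * ε ^ q * ((α / 2) ^ (1 / (1 - p i)) *
        ∫ x, Z.indicator (fun x => |b i x| ^ conjExp (p i)) x ∂μ) := by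
    intro i
    rw [integral_add ((hI1 i).const_mul _) (((hI2 i).const_mul _).const_mul _),
      integral_const_mul, integral_const_mul, integral_const_mul, neg_mul]
  simp_rw [hsplit] at hfin
  rw [Finset.sum_add_distrib, ← Finset.mul_sum, Finset.sum_neg_distrib] at hfin
  -- All directions enter the energy with the same sign, so those other than `j` may be dropped.
  have hsingle : α / 2 * ∫ x, D x * |W10.grad u x j| ^ p j ∂μ ≤
      ∑ i, α / 2 * ∫ x, D x * |W10.grad u x i| ^ p i ∂μ :=
    Finset.single_le_sum (f := fun i => α / 2 * ∫ x, D x * |W10.grad u x i| ^ p i ∂μ)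
      (fun i _ => mul_nonneg (by positivity) (integral_nonneg fun x => by positivity))
      (Finset.mem_univ j)
  linarith

end

/-! ### Decay of the sublevel sets and conclusion -/

open Filter Topology

variable {N : ℕ} {Ω : Opens (EuclideanSpace ℝ (Fin N))} {p : Fin N → ℝ} [hp : ∀ i, Fact (1 < p i)]

/-- The measure of a sublevel set of `u` is controlled by the energy of the truncation. -/
theorem W10.measure_sublevel_le (hΩ : Bornology.IsBounded (Ω : Set (EuclideanSpace ℝ (Fin N))))
    (u : W10 Ω p) {C R : ℝ} (hC : ∀ s, |deriv Real.smoothTransition s| ≤ C) (hR : 0 < R)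
    (hΩR : ∀ x ∈ Ω, ∀ i, |x i| ≤ R) {ε κ : ℝ} (hε : 0 < ε) (hκ : 0 < κ) (j : Fin N) :
    (volume.restrict (Ω : Set (EuclideanSpace ℝ (Fin N)))).real {x | W10.val u x ≤ -ε} ≤
      R * C * (volume (Ω : Set (EuclideanSpace ℝ (Fin N)))).toReal * κ +
      R * κ ^ (1 - p j) * ε ^ (-p j) *
        ∫ x in Ω, |deriv (negTrunc ε) (W10.val u x)| * |W10.grad u x j| ^ p j := by
  set μ := volume.restrict (Ω : Set (EuclideanSpace ℝ (Fin N))) with hμ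
  have : IsFiniteMeasure μ := ⟨by simpa [hμ] using hΩ.measure_lt_top⟩
  have hvm := (W10.memLp_val u).1
  have hpj : 1 < p j := (hp j).out
  have hHC : ∀ s, |deriv (negTrunc ε) s| ≤ C := fun s => by
    rw [deriv_negTrunc hε, abs_neg]
    exact hC _
  have hC0 : 0 ≤ C := (abs_nonneg _).trans (hC 0)
  have hHb : ∀ s, |negTrunc ε s| ≤ ε := fun s => by
    rw [abs_of_nonneg (negTrunc_nonneg hε s)]
    exact negTrunc_le hε s
  have hDm : AEStronglyMeasurable (fun x => |deriv (negTrunc ε) (W10.val u x)|) μ :=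
    ((contDiff_negTrunc ε (n := 1)).continuous_deriv le_rfl).abs.comp_aestronglyMeasurable hvm
  have hI : Integrable (fun x => |deriv (negTrunc ε) (W10.val u x)| * |W10.grad u x j| ^ p j) μ :=
    (W10.integrable_grad_rpow u j).bdd_mul (c := C) hDm (.of_forall fun x => by
      rw [Real.norm_eq_abs, abs_abs]
      exact hHC _)
  have hHint : Integrable (fun x => negTrunc ε (W10.val u x)) μ :=
    Integrable.of_bound ((contDiff_negTrunc ε (n := 0)).continuous.comp_aestronglyMeasurable hvm) ε
      (.of_forall fun x => hHb _)
  have hmarkov : ε * μ.real {x | W10.val u x ≤ -ε} ≤ ∫ x, negTrunc ε (W10.val u x) ∂μ := by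
    refine le_trans ?_ (mul_meas_ge_le_integral_of_nonneg
      (.of_forall fun x => negTrunc_nonneg hε _) hHint ε)
    refine mul_le_mul_of_nonneg_left (measureReal_mono fun x hx => ?_) hε.le
    exact (negTrunc_of_le hε hx).ge
  have hpoinc : ∫ x, negTrunc ε (W10.val u x) ∂μ ≤ ∫ x, (R * C * (κ * ε) +
      R * (κ * ε) ^ (1 - p j) * (|deriv (negTrunc ε) (W10.val u x)| * |W10.grad u x j| ^ p j)) ∂μ := by
    rw [W10.integral_comp_eq hΩ u j (contDiff_negTrunc ε) (negTrunc_of_nonneg hε le_rfl) hHb hHC]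
    refine (neg_le_abs _).trans ?_
    rw [← Real.norm_eq_abs]
    refine norm_integral_le_of_norm_le (g := fun x => R * C * (κ * ε) +
      R * (κ * ε) ^ (1 - p j) * (|deriv (negTrunc ε) (W10.val u x)| * |W10.grad u x j| ^ p j))
      ((integrable_const _).add (hI.const_mul _)) ?_
    refine (ae_restrict_iff' Ω.isOpen.measurableSet).2 (.of_forall fun x hx => ?_)
    rw [norm_mul, norm_mul, Real.norm_eq_abs, Real.norm_eq_abs, Real.norm_eq_abs]
    -- The scale `κ ε` is proportional to the height of the truncation: after division by `ε` the
    -- first term is `κ` times a constant, and the second carries `ε^{-pⱼ}`.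
    have h1 := le_add_rpow hpj (mul_pos hκ hε) (abs_nonneg (W10.grad u x j))
    have h2 := hHC (W10.val u x)
    calc |x j| * (|deriv (negTrunc ε) (W10.val u x)| * |W10.grad u x j|)
        ≤ R * (|deriv (negTrunc ε) (W10.val u x)| *
          (κ * ε + (κ * ε) ^ (1 - p j) * |W10.grad u x j| ^ p j)) := by
          gcongr
          exact hΩR x hx j
      _ = R * (|deriv (negTrunc ε) (W10.val u x)| * (κ * ε)) + R * (κ * ε) ^ (1 - p j) *
          (|deriv (negTrunc ε) (W10.val u x)| * |W10.grad u x j| ^ p j) := by ring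
      _ ≤ R * (C * (κ * ε)) + _ := by gcongr
      _ = _ := by ring
  rw [integral_add (integrable_const _) (hI.const_mul _), integral_const, integral_const_mul] at hpoinc
  have hμu : μ.real univ = (volume (Ω : Set (EuclideanSpace ℝ (Fin N)))).toReal := by
    simp [hμ, Measure.real]
  rw [hμu, smul_eq_mul] at hpoinc
  have h1 := hmarkov.trans hpoinc
  have e : ε * ε ^ (-p j) = ε ^ (1 - p j) := by
    rw [sub_eq_add_neg, Real.rpow_add hε, Real.rpow_one]
  refine le_of_mul_le_mul_left (h1.trans (le_of_eq ?_)) hε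
  rw [Real.mul_rpow hκ.le hε.le, ← e]
  ring

/-- Quantitative smallness of the sublevel sets of a solution with nonnegative datum. -/
theorem IsWeakSolution.measure_sublevel_le
    {A : Fin N → EuclideanSpace ℝ (Fin N) → (Fin N → ℝ) → ℝ}
    {B : Fin N → EuclideanSpace ℝ (Fin N) → ℝ → ℝ} {G : EuclideanSpace ℝ (Fin N) → ℝ → ℝ}
    {F : StrongDual ℝ (W10 Ω p)} {u : W10 Ω p} (hu : IsWeakSolution A B G F u)
    (hF : DualNonneg F) (hN : 2 ≤ N) (hpN : harmonicMean p < N)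
    (hΩ : Bornology.IsBounded (Ω : Set (EuclideanSpace ℝ (Fin N))))
    {α : ℝ} {β : Fin N → ℝ} (hA : HypA Ω p A α β)
    {b : Fin N → EuclideanSpace ℝ (Fin N) → ℝ} (hB : HypB Ω p B b)
    (hG : Integrable (fun x => G x (W10.val u x))
      (volume.restrict (Ω : Set (EuclideanSpace ℝ (Fin N)))))
    (hGs : ∀ᵐ x ∂(volume.restrict (Ω : Set (EuclideanSpace ℝ (Fin N)))), ∀ s : ℝ, 0 ≤ G x s * s)
    {C R : ℝ} (hC : ∀ s, |deriv Real.smoothTransition s| ≤ C) (hR : 0 < R)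
    (hΩR : ∀ x ∈ Ω, ∀ i, |x i| ≤ R) {ε κ : ℝ} (hε : 0 < ε) (hε1 : ε ≤ 1) (hκ : 0 < κ) {j : Fin N}
    (hj : p j ≤ harmonicMean p) :
    (volume.restrict (Ω : Set (EuclideanSpace ℝ (Fin N)))).real {x | W10.val u x ≤ -ε} ≤
      R * C * (volume (Ω : Set (EuclideanSpace ℝ (Fin N)))).toReal * κ +
        R * κ ^ (1 - p j) * (2 / α * C) * ∑ i, (α / 2) ^ (1 / (1 - p i)) *
          ∫ x in Ω, {x | -ε < W10.val u x ∧ W10.val u x < 0}.indicator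
            (fun x => |b i x| ^ conjExp (p i)) x := by
  have hα := hA.alpha_pos
  have hC0 : 0 ≤ C := (abs_nonneg _).trans (hC 0)
  have h1 := W10.measure_sublevel_le hΩ u hC hR hΩR hε hκ j
  have h2 := hu.energy_le hF hN hpN hΩ hA hB hG hGs hC hε j
  have hI0 : 0 ≤ ∑ i, (α / 2) ^ (1 / (1 - p i)) *
      ∫ x in Ω, {x | -ε < W10.val u x ∧ W10.val u x < 0}.indicator
        (fun x => |b i x| ^ conjExp (p i)) x :=
    Finset.sum_nonneg fun i _ => mul_nonneg (by positivity)
      (integral_nonneg fun x => indicator_nonneg (fun x _ => by positivity) x)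
  generalize (∑ i, (α / 2) ^ (1 / (1 - p i)) *
      ∫ x in Ω, {x | -ε < W10.val u x ∧ W10.val u x < 0}.indicator
        (fun x => |b i x| ^ conjExp (p i)) x) = I at h2 hI0 ⊢
  generalize (∫ x in Ω, |deriv (negTrunc ε) (W10.val u x)| * |W10.grad u x j| ^ p j) = E at h1 h2
  have h3 : ε ^ (-p j) * E ≤ 2 / α * C * I := by
    have h4 : E ≤ 2 / α * (C * ε ^ harmonicMean p * I) := by
      rw [div_mul_eq_mul_div, le_div_iff₀ hα]
      linarith
    -- The choice of a direction with `pⱼ ≤ p̄` enters here: the energy gain `ε^{p̄}` compensates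
    -- the loss `ε^{-pⱼ}`.
    have h5 : ε ^ (-p j) * ε ^ harmonicMean p ≤ 1 := by
      rw [← Real.rpow_add hε]
      exact Real.rpow_le_one hε.le hε1 (by linarith)
    calc ε ^ (-p j) * E ≤ ε ^ (-p j) * (2 / α * (C * ε ^ harmonicMean p * I)) := by gcongr
      _ = (ε ^ (-p j) * ε ^ harmonicMean p) * (2 / α * C * I) := by ring
      _ ≤ 1 * (2 / α * C * I) := by gcongr
      _ = _ := one_mul _
  have h6 : R * κ ^ (1 - p j) * (ε ^ (-p j) * E) ≤ R * κ ^ (1 - p j) * (2 / α * C * I) := by gcongr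
  linarith

/-- The integral over `{-1/(n+1) < f < 0}` tends to zero. -/
theorem tendsto_integral_indicator_band {E : Type*} [MeasurableSpace E] {μ : Measure E}
    {f g : E → ℝ} (hg : Integrable g μ) (hg0 : ∀ x, 0 ≤ g x) (hf : AEMeasurable f μ) :
    Tendsto (fun n : ℕ => ∫ x, {x | -(1 / ((n : ℝ) + 1)) < f x ∧ f x < 0}.indicator g x ∂μ)
      atTop (𝓝 0) := by
  suffices Tendsto (fun n : ℕ => ∫ x, {x | -(1 / ((n : ℝ) + 1)) < f x ∧ f x < 0}.indicator g x ∂μ)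
      atTop (𝓝 (∫ _, (0 : ℝ) ∂μ)) by rwa [integral_zero] at this
  refine tendsto_integral_of_dominated_convergence _ (fun n => ?_) hg
    (fun n => .of_forall fun x => ?_) (.of_forall fun x => ?_)
  · exact hg.1.indicator₀ ((nullMeasurableSet_lt aemeasurable_const hf).inter
      (nullMeasurableSet_lt hf aemeasurable_const))
  · rw [Real.norm_of_nonneg (indicator_nonneg (fun x _ => hg0 x) x)]
    exact indicator_le_self' (fun x _ => hg0 x) x
  · refine tendsto_const_nhds.congr' ?_
    -- The bands exclude the level `0`, so every point leaves them eventually, even if `{f = 0}` has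
    -- positive measure.
    have hx : ∀ᶠ n : ℕ in atTop, x ∉ {x | -(1 / ((n : ℝ) + 1)) < f x ∧ f x < 0} := by
      rcases le_or_gt 0 (f x) with h | h
      · exact .of_forall fun n hn => absurd hn.2 (not_lt.2 h)
      · filter_upwards [tendsto_one_div_add_atTop_nhds_zero_nat.eventually_lt_const
          (neg_pos.2 h)] with n hn hn'
        have h1 := hn'.1
        linarith
    filter_upwards [hx] with n hn
    refine (indicator_of_notMem ?_ _).symm
    exact hn

/-- A function is nonnegative if the measures of its sublevel sets at small negative levels are
small. -/
theorem ae_nonneg_of_measure_sublevel_le {E : Type*} [MeasurableSpace E] {μ : Measure E}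
    [IsFiniteMeasure μ] {f : E → ℝ} {J : ℕ → ℝ} {a : ℝ} {c : ℝ → ℝ}
    (hJ : Tendsto J atTop (𝓝 0))
    (hmeas : ∀ n : ℕ, ∀ κ : ℝ, 0 < κ → μ.real {x | f x ≤ -(1 / ((n : ℝ) + 1))} ≤
      a * κ + c κ * J n) : ∀ᵐ x ∂μ, 0 ≤ f x := by
  have hzero : ∀ m : ℕ, μ {x | f x ≤ -(1 / ((m : ℝ) + 1))} = 0 := by
    intro m
    rw [← measureReal_eq_zero_iff]
    refine le_antisymm ?_ measureReal_nonneg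
    have hκ : ∀ κ : ℝ, 0 < κ → μ.real {x | f x ≤ -(1 / ((m : ℝ) + 1))} ≤
        a * κ := by
      intro κ hκ
      have hlim := (hJ.const_mul (c κ)).const_add
        (a * κ)
      rw [mul_zero, add_zero] at hlim
      refine ge_of_tendsto hlim ?_
      -- The sublevel set at level `m` is contained in all later ones, so `n → ∞` with `κ` fixed
      -- removes `c κ * J n`. Only then does `κ → 0`: no bound on `c` near `0` is assumed.
      filter_upwards [Filter.eventually_ge_atTop m] with n hn
      refine (measureReal_mono fun x hx => ?_).trans (hmeas n κ hκ)
      have : (1 / ((n : ℝ) + 1)) ≤ (1 / ((m : ℝ) + 1)) := Nat.one_div_le_one_div hn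
      simp only [mem_ofPred_eq] at hx ⊢
      linarith
    have hlim : Filter.Tendsto (fun κ : ℝ => a * κ) (nhdsWithin 0 (Ioi 0)) (nhds 0) := by
      have : Filter.Tendsto (fun κ : ℝ => a * κ) (nhds 0) (nhds _) :=
        (continuous_const_mul _).tendsto 0
      rw [mul_zero] at this
      exact this.mono_left nhdsWithin_le_nhds
    refine ge_of_tendsto hlim ?_
    filter_upwards [self_mem_nhdsWithin] with κ hκ' using hκ κ hκ'
  have hall : ∀ᵐ x ∂μ, ∀ m : ℕ, ¬ f x ≤ -(1 / ((m : ℝ) + 1)) :=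
    ae_all_iff.2 fun m => by
      rw [ae_iff]
      simpa only [not_not] using hzero m
  filter_upwards [hall] with x hx
  by_contra! h
  obtain ⟨m, hm⟩ := exists_nat_one_div_lt (neg_pos.2 h)
  refine hx m ?_
  linarith

end Aniso

end

theorem proposition5 {N : ℕ} (hN : 2 < N)
    (Ω : Opens (EuclideanSpace ℝ (Fin N)))
    (hΩ : Bornology.IsBounded (Ω : Set (EuclideanSpace ℝ (Fin N))))
    (p : Fin N → ℝ) [∀ i, Fact (1 < p i)] (hp : Aniso.harmonicMean p < N)
    (A : Fin N → EuclideanSpace ℝ (Fin N) → (Fin N → ℝ) → ℝ)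
    (B : Fin N → EuclideanSpace ℝ (Fin N) → ℝ → ℝ)
    (G : EuclideanSpace ℝ (Fin N) → ℝ → ℝ)
    (F : StrongDual ℝ (Aniso.W10 Ω p))
    (hA : ∃ (α : ℝ) (β : Fin N → ℝ), Aniso.HypA Ω p A α β)
    (hB : ∃ b : Fin N → EuclideanSpace ℝ (Fin N) → ℝ, Aniso.HypB Ω p B b)
    (hG : (∃ μ γ : ℝ, Aniso.HypG Ω p G μ γ) ∨
      ∀ᵐ x ∂(volume.restrict (Ω : Set (EuclideanSpace ℝ (Fin N)))), ∀ s : ℝ, G x s = 0)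
    (u : Aniso.W10 Ω p) (hu : Aniso.IsWeakSolution A B G F u)
    (hF : Aniso.DualNonneg F) :
    ∀ᵐ x ∂(volume.restrict (Ω : Set (EuclideanSpace ℝ (Fin N)))), 0 ≤ Aniso.W10.val u x := by
  obtain ⟨α, β, hA⟩ := hA
  obtain ⟨b, hB⟩ := hB
  set μ := volume.restrict (Ω : Set (EuclideanSpace ℝ (Fin N))) with hμ
  have hfin : IsFiniteMeasure μ := ⟨by simpa [hμ] using hΩ.measure_lt_top⟩
  have hp1 : ∀ i, 1 < p i := fun i => Fact.out
  have hGint : Integrable (fun x => G x (Aniso.W10.val u x)) μ := by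
    rcases hG with ⟨m, γ, hG⟩ | hG
    · exact hG.integrable hN.le hp hΩ u
    · refine (integrable_zero _ _ μ).congr ?_
      filter_upwards [hG] with x hx
      exact (hx _).symm
  have hGs : ∀ᵐ x ∂μ, ∀ s : ℝ, 0 ≤ G x s * s := by
    rcases hG with ⟨m, γ, hG⟩ | hG
    · exact hG.sign
    · filter_upwards [hG] with x hx s
      rw [hx s, zero_mul]
  obtain ⟨C, hC0, hC⟩ := Aniso.exists_deriv_smoothTransition_le
  obtain ⟨R, hR, hΩR⟩ := Aniso.exists_coord_bound hΩ
  obtain ⟨j, hj⟩ := Aniso.exists_le_harmonicMean (by omega) hp1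
  -- The levels are `ε = 1/(n+1)`. They satisfy `ε ≤ 1`, as the cancellation of the powers of `ε`
  -- requires.
  refine Aniso.ae_nonneg_of_measure_sublevel_le
    (J := fun n : ℕ => ∑ i, (α / 2) ^ (1 / (1 - p i)) *
      ∫ x in Ω, {x | -(1 / ((n : ℝ) + 1)) < Aniso.W10.val u x ∧ Aniso.W10.val u x < 0}.indicator
        (fun x => |b i x| ^ Aniso.conjExp (p i)) x)
    (a := R * C * (volume (Ω : Set (EuclideanSpace ℝ (Fin N)))).toReal)
    (c := fun κ => R * κ ^ (1 - p j) * (2 / α * C)) ?_ fun n κ hκ =>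
      hu.measure_sublevel_le hF hN.le hp hΩ hA hB hGint hGs hC hR hΩR Nat.one_div_pos_of_nat ?_ hκ hj
  · have h := tendsto_finsetSum Finset.univ fun i _ => (Aniso.tendsto_integral_indicator_band
      (hB.integrable_rpow hN.le hp hΩ.measure_lt_top.ne i) (fun x => by positivity)
      (Aniso.W10.memLp_val u).1.aemeasurable).const_mul ((α / 2) ^ (1 / (1 - p i)))
    simpa only [mul_zero, Finset.sum_const_zero] using h
  · rw [div_le_one (by positivity)]
    linarith [(Nat.cast_nonneg n : (0 : ℝ) ≤ n)]
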